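/- Let $G$ be a compact Lie group with normalised Haar measure $dx$, and let $\widehat G$ be the set of equivalence classes of continuous irreducible unitary representations of $G$. For every class choose a representative $\xi$, written in an orthonormal basis as a matrix function $\xi:G\to U(d_\xi)$, and put $\widehat f(\xi)=\int_G f(x)\,\xi(x)^*\,dx$. For $B\in\mathbb C^{d\times d}$ let $\|B\|_{op(\ell^\infty,\ell^\infty)}=\max_i\sum_j|B_{ij}|$. A continuous linear operator $A:C^\infty(G)\to\mathcal D'(G)$ is said to have the matrix symbol $\sigma$ if for every $[\xi]\in\widehat G$ the distributions $A\xi_{ij}$ are integrable functions and, with $(A\xi)_{ij}=A\xi_{ij}$, one has $\sigma(x,\xi)=\xi(x)^*(A\xi)(x)$ for almost every $x\in G$. For $0<r\le 1$, a bounded linear operator $T:E\to F$ between Banach spaces is $r$-nuclear if there are $x_n'\in E'$ and $y_n\in F$ with $Tx=\sum_n\langle x,x_n'\rangle y_n$ for all $x\in E$ and $\sum_n\|x_n'\|_{E'}^r\|y_n\|_F^r<\infty$. Let $0<r\le 1$ and $1\le p_1,p_2<\infty$, and put $\widetilde{p_1}=\min\{2,p_1\}$. For every $[\xi]\in\widehat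 G$ let $\sigma(\cdot,\xi):G\to\mathbb C^{d_\xi\times d_\xi}$ be measurable (no further regularity is assumed), and suppose that $$\sum_{[\xi]\in\widehat G}d_\xi^{\,2+\frac{r}{\widetilde{p_1}}}\,\Big\|\,\|\sigma(x,\xi)^t\|_{op(\ell^\infty,\ell^\infty)}\Big\|_{L^{p_2}(G)}^r<\infty .$$ Then there is an $r$-nuclear operator $T:L^{p_1}(G)\to L^{p_2}(G)$ such that: 1. for every $f\in L^{p_1}(G)$, for almost every $x\in G$, the following series converges absolutely and $$Tf(x)=\sum_{[\xi]\in\widehat G}d_\xi\operatorname{Tr}\big(\xi(x)\,\sigma(x,\xi)\,\widehat f(\xi)\big);$$ 2. $T$ extends every operator with the symbol $\sigma$: if $A:C^\infty(G)\to\mathcal D'(G)$ is continuous, linear and has the matrix symbol $\sigma$, then $Af=Tf$ in $\mathcal D'(G)$ for all $f\in C^\infty(G)$. -/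

import Mathlib

open MeasureTheory Filter Topology
open scoped Manifold ContDiff ENNReal NNReal Matrix

noncomputable section

namespace RNuclear

/-! ### `r`-nuclear operators -/

/-- A bounded operator `T : E → F` between complex Banach spaces is `r`-nuclear if
`T x = ∑ ⟨x, x'ₙ⟩ yₙ` for all `x`, with `∑ ‖x'ₙ‖ ^ r * ‖yₙ‖ ^ r < ∞`. -/
def IsRNuclear {E F : Type*} [NormedAddCommGroup E] [NormedSpace ℂ E]
    [NormedAddCommGroup F] [NormedSpace ℂ F] (r : ℝ) (T : E →L[ℂ] F) : Prop :=
  ∃ (x' : ℕ → E →L[ℂ] ℂ) (y : ℕ → F),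
    (∀ x : E, HasSum (fun n => x' n x • y n) (T x)) ∧
      Summable (fun n => ‖x' n‖ ^ r * ‖y n‖ ^ r)

/-! ### The unitary dual -/

/-- The representation on `ℂⁿ` given by a homomorphism into the unitary group `U(n)`. -/
def matrixRep {G : Type*} [Group G] {n : ℕ} (ρ : G →* Matrix.unitaryGroup (Fin n) ℂ) :
    Representation ℂ G (Fin n → ℂ) where
  toFun g := Matrix.toLin' (ρ g : Matrix (Fin n) (Fin n) ℂ)
  map_one' := by simp; rfl
  map_mul' g h := by simp [Matrix.toLin'_mul]; rfl

/-- A continuous irreducible unitary representation of `G`, written in an orthonormal basis of the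
representation space, i.e. as a homomorphism to some `U(d)`. (For compact `G`, every continuous
irreducible unitary representation on a Hilbert space is of this form.) -/
structure IrrepMatrix (G : Type*) [Group G] [TopologicalSpace G] where
  /-- The dimension `d_ξ`. -/
  dim : ℕ
  /-- The unitary matrices `ξ(x)`. -/
  hom : G →* Matrix.unitaryGroup (Fin dim) ℂ
  continuous_hom : Continuous hom
  irreducible : (matrixRep hom).IsIrreducible

section Dual

variable {G : Type*} [Group G] [TopologicalSpace G]

/-- The matrix `ξ(x)`. -/
def IrrepMatrix.mat (ξ : IrrepMatrix G) (x : G) : Matrix (Fin ξ.dim) (Fin ξ.dim) ℂ :=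
  (ξ.hom x : Matrix (Fin ξ.dim) (Fin ξ.dim) ℂ)

/-- Unitary equivalence of representations. -/
def IrrepMatrix.Equivalent (ξ η : IrrepMatrix G) : Prop :=
  ∃ U : Matrix (Fin η.dim) (Fin ξ.dim) ℂ, Uᴴ * U = 1 ∧ U * Uᴴ = 1 ∧
    ∀ x, U * ξ.mat x = η.mat x * U

variable (G) in
instance irrepSetoid : Setoid (IrrepMatrix G) where
  r := IrrepMatrix.Equivalent
  iseqv :=
    { refl := fun ξ => ⟨1, by simp, by simp, fun x => by simp⟩
      symm := by
        rintro ξ η ⟨U, h1, h2, h⟩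
        refine ⟨Uᴴ, by simpa using h2, by simpa using h1, fun x => ?_⟩
        calc Uᴴ * η.mat x = Uᴴ * (η.mat x * U) * Uᴴ := by
              rw [Matrix.mul_assoc, Matrix.mul_assoc, h2, Matrix.mul_one]
          _ = (Uᴴ * U) * ξ.mat x * Uᴴ := by rw [← h x]; simp only [Matrix.mul_assoc]
          _ = ξ.mat x * Uᴴ := by rw [h1, Matrix.one_mul]
      trans := by
        rintro ξ η ζ ⟨U, h1, h2, h⟩ ⟨V, k1, k2, k⟩
        refine ⟨V * U, ?_, ?_, fun x => ?_⟩
        · rw [Matrix.conjTranspose_mul, Matrix.mul_assoc, ← Matrix.mul_assoc Vᴴ, k1,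
            Matrix.one_mul, h1]
        · rw [Matrix.conjTranspose_mul, Matrix.mul_assoc, ← Matrix.mul_assoc U, h2,
            Matrix.one_mul, k2]
        · rw [Matrix.mul_assoc, h x, ← Matrix.mul_assoc, k x, Matrix.mul_assoc] }

variable (G) in
/-- The unitary dual `Ĝ`: equivalence classes of continuous irreducible unitary representations. -/
def UnitaryDual : Type _ := Quotient (irrepSetoid G)

/-- `ξ` chooses a matrix representative `ξ c` of each class `c = [ξ] ∈ Ĝ`. -/
def IsChoiceOfRepresentatives (ξ : UnitaryDual G → IrrepMatrix G) : Prop :=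
  ∀ c : UnitaryDual G, Quotient.mk (irrepSetoid G) (ξ c) = c

end Dual

/-! ### Smooth functions and distributions -/

section Smooth

variable {E : Type*} [NormedAddCommGroup E] [NormedSpace ℝ E]
  {H : Type*} [TopologicalSpace H] (I : ModelWithCorners ℝ E H)
  (G : Type*) [TopologicalSpace G] [ChartedSpace H G]

/-- The complex vector space of smooth functions `G → ℂ`, as a subspace of all functions. -/
def smoothSubmodule : Submodule ℂ (G → ℂ) where
  carrier := {f | ContMDiff I 𝓘(ℝ, ℂ) ∞ f}
  add_mem' hf hg := ContMDiff.add hf hg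
  zero_mem' := contMDiff_const
  smul_mem' c f hf := by
    have h : ContMDiff I 𝓘(ℝ, ℂ) ∞ ((fun z : ℂ => c * z) ∘ f) :=
      (ContDiff.contMDiff (by fun_prop)).comp hf
    exact h

/-- The space `C^∞(G)`. -/
def SmoothFun : Type _ := smoothSubmodule I G

instance : AddCommGroup (SmoothFun I G) := inferInstanceAs (AddCommGroup (smoothSubmodule I G))

instance : Module ℂ (SmoothFun I G) := inferInstanceAs (Module ℂ (smoothSubmodule I G))

instance : CoeFun (SmoothFun I G) (fun _ => G → ℂ) := ⟨fun f => f.1⟩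

variable {I G}

theorem SmoothFun.continuous (f : SmoothFun I G) : Continuous (f : G → ℂ) :=
  ContMDiff.continuous (show ContMDiff I 𝓘(ℝ, ℂ) ∞ (f : G → ℂ) from f.2)

variable [Group G]

/-- The derivative `X_v f` of `f : G → ℂ` along the left-invariant vector field `X_v` whose value
at the identity is `v`. -/
def lieDeriv (v : GroupLieAlgebra I G) (f : G → ℂ) (x : G) : ℂ :=
  mfderiv I 𝓘(ℝ, ℂ) f x (mulInvariantVectorField v x)

/-- `X_{v₁} X_{v₂} ⋯ X_{vₖ} f` for the list `[v₁, …, vₖ]`. -/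
def iteratedLieDeriv (l : List (GroupLieAlgebra I G)) (f : G → ℂ) : G → ℂ :=
  l.foldr lieDeriv f

/-- The usual topology of `C^∞(G)` for compact `G`: uniform convergence of all iterated derivatives
along left-invariant vector fields (these fields span every tangent space). -/
instance : TopologicalSpace (SmoothFun I G) :=
  TopologicalSpace.induced
    (fun f (l : List (GroupLieAlgebra I G)) => UniformFun.ofFun (iteratedLieDeriv l (f : G → ℂ)))
    inferInstance

variable (I G) in
/-- The space `𝒟'(G)` of distributions on a compact Lie group: continuous linear functionals on
`C^∞(G)`, with the topology of pointwise convergence. -/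
abbrev Distrib : Type _ := SmoothFun I G →Lₚₜ[ℂ] ℂ

variable [MeasurableSpace G]

/-- The distribution `u` is given by the integrable function `g`. -/
def Distrib.IsRepresentedBy (u : Distrib I G) (g : G → ℂ) (μ : Measure G) : Prop :=
  Integrable g μ ∧ ∀ φ : SmoothFun I G, u φ = ∫ x, g x * φ x ∂μ

/-- A smooth function on a compact Lie group as an element of `L^p`. -/
def SmoothFun.toLp [CompactSpace G] [BorelSpace G] (f : SmoothFun I G) (p : ℝ≥0∞)
    (μ : Measure G) [IsFiniteMeasure μ] : Lp ℂ p μ :=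
  MemLp.toLp (f : G → ℂ)
    ((f.continuous.memLp_of_hasCompactSupport (HasCompactSupport.of_compactSpace _)))

/-! ### Matrix symbols -/

/-- `σ` is the matrix symbol of `A`: for each `[ξ]`, the distributions `A ξᵢⱼ` are given by
functions `(Aξ)ᵢⱼ`, and `σ(x, ξ) = ξ(x)^* (Aξ)(x)` for almost every `x`. (The matrix coefficients
`ξᵢⱼ` of a continuous representation of a Lie group are smooth, so that exactly one `u` with the
property below exists.) -/
def IsMatrixSymbol (A : SmoothFun I G →L[ℂ] Distrib I G) (μ : Measure G)
    (ξ : UnitaryDual G → IrrepMatrix G)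
    (σ : ∀ c : UnitaryDual G, G → Matrix (Fin (ξ c).dim) (Fin (ξ c).dim) ℂ) : Prop :=
  ∀ c : UnitaryDual G, ∃ Aξ : G → Matrix (Fin (ξ c).dim) (Fin (ξ c).dim) ℂ,
    (∀ i j, ∀ u : SmoothFun I G, (∀ x, u x = (ξ c).mat x i j) →
      (A u).IsRepresentedBy (fun x => Aξ x i j) μ) ∧
    ∀ᵐ x ∂μ, σ c x = ((ξ c).mat x)ᴴ * Aξ x

end Smooth

/-- The Fourier coefficient `f̂(ξ) = ∫ f(x) ξ(x)^* dx`, taken entrywise. -/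
def fourierCoeff {G : Type*} [Group G] [TopologicalSpace G] [MeasurableSpace G]
    (μ : Measure G) (f : G → ℂ) (ξ : IrrepMatrix G) : Matrix (Fin ξ.dim) (Fin ξ.dim) ℂ :=
  Matrix.of fun i j => ∫ x, f x * (ξ.mat x)ᴴ i j ∂μ

/-- The operator norm of a matrix on `(ℂ^d, ℓ^∞)`: the maximal absolute row sum. -/
def opNormLinfty {d : ℕ} (B : Matrix (Fin d) (Fin d) ℂ) : ℝ≥0 :=
  Finset.univ.sup fun i => ∑ j, ‖B i j‖₊

end RNuclear

end

set_option linter.unusedSectionVars false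

namespace RNuclear

/-! ### Schur orthogonality -/

section Schur

variable {G : Type*} [Group G] [TopologicalSpace G]

namespace IrrepMatrix

theorem mat_mul (ξ : IrrepMatrix G) (x y : G) : ξ.mat (x * y) = ξ.mat x * ξ.mat y := by
  simp [mat]

theorem mat_one (ξ : IrrepMatrix G) : ξ.mat 1 = 1 := by
  simp [mat]

theorem mat_inv (ξ : IrrepMatrix G) (x : G) : ξ.mat x⁻¹ = (ξ.mat x)ᴴ := by
  simp [mat, Matrix.star_eq_conjTranspose]

theorem mat_mul_conjTranspose (ξ : IrrepMatrix G) (x : G) : ξ.mat x * (ξ.mat x)ᴴ = 1 := by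
  rw [← mat_inv, ← mat_mul, mul_inv_cancel, mat_one]

theorem conjTranspose_mul_mat (ξ : IrrepMatrix G) (x : G) : (ξ.mat x)ᴴ * ξ.mat x = 1 := by
  rw [← mat_inv, ← mat_mul, inv_mul_cancel, mat_one]

theorem continuous_mat (ξ : IrrepMatrix G) : Continuous ξ.mat :=
  continuous_subtype_val.comp ξ.continuous_hom

theorem continuous_mat_apply (ξ : IrrepMatrix G) (i j : Fin ξ.dim) :
    Continuous fun x => ξ.mat x i j :=
  ξ.continuous_mat.matrix_elem i j

theorem norm_mat_apply_le (ξ : IrrepMatrix G) (x : G) (i j : Fin ξ.dim) : ‖ξ.mat x i j‖ ≤ 1 :=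
  entry_norm_bound_of_unitary (ξ.hom x).2 i j

theorem dim_pos (ξ : IrrepMatrix G) : 0 < ξ.dim := by
  have := ξ.irreducible
  rcases Nat.eq_zero_or_pos ξ.dim with h | h
  · exfalso
    obtain ⟨a, b, hab⟩ := exists_pair_ne (Subrepresentation (matrixRep ξ.hom))
    apply hab
    ext v
    have : IsEmpty (Fin ξ.dim) := by rw [h]; infer_instance
    have hv : v = 0 := Subsingleton.elim _ _
    subst hv
    exact ⟨fun _ => b.toSubmodule.zero_mem, fun _ => a.toSubmodule.zero_mem⟩
  · exact h

theorem matrixRep_apply (ξ : IrrepMatrix G) (x : G) (v : Fin ξ.dim → ℂ) :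
    matrixRep ξ.hom x v = ξ.mat x *ᵥ v := by
  simp [matrixRep, mat]

/-- Schur's lemma: a self-intertwiner is scalar. -/
theorem eq_smul_one_of_commute (ξ : IrrepMatrix G) (M : Matrix (Fin ξ.dim) (Fin ξ.dim) ℂ)
    (hM : ∀ x, M * ξ.mat x = ξ.mat x * M) : ∃ c : ℂ, M = c • (1 : Matrix _ _ ℂ) := by
  have := ξ.irreducible
  let f : Representation.IntertwiningMap (matrixRep ξ.hom) (matrixRep ξ.hom) :=
    (Matrix.toLin' M).intertwiningMap_of_isIntertwiningMap _ _ (by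
      intro g v
      simp only [Matrix.toLin'_apply, matrixRep_apply, Matrix.mulVec_mulVec, hM])
  obtain ⟨c, hc⟩ :=
    (Representation.IsIrreducible.algebraMap_intertwiningMap_bijective_of_isAlgClosed
      (ρ := matrixRep ξ.hom)).2 f
  refine ⟨c, Matrix.toLin'.injective ?_⟩
  have := congrArg (fun g => g.toLinearMap) hc
  ext1 v
  have h2 := LinearMap.congr_fun this
  refine LinearMap.ext fun w => ?_
  have := h2 (LinearMap.single ℂ (fun _ => ℂ) v w)
  simp only [LinearMap.comp_apply]
  rw [show (Matrix.toLin' M) = f.toLinearMap from rfl, ← this]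
  simp [Representation.IntertwiningMap.algebraMap_apply]

/-- A nonzero intertwiner yields a unitary equivalence. -/
theorem equivalent_of_intertwiner (ξ η : IrrepMatrix G) (M : Matrix (Fin η.dim) (Fin ξ.dim) ℂ)
    (hM : ∀ x, M * ξ.mat x = η.mat x * M) (h0 : M ≠ 0) : ξ.Equivalent η := by
  have hM' : ∀ x, Mᴴ * η.mat x = ξ.mat x * Mᴴ := by
    intro x
    have := congrArg Matrix.conjTranspose (hM x⁻¹)
    simpa [Matrix.conjTranspose_mul, mat_inv] using this.symm
  obtain ⟨c, hc⟩ := ξ.eq_smul_one_of_commute (Mᴴ * M) (fun x => by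
    rw [Matrix.mul_assoc, hM, ← Matrix.mul_assoc, hM', Matrix.mul_assoc])
  obtain ⟨c', hc'⟩ := η.eq_smul_one_of_commute (M * Mᴴ) (fun x => by
    rw [Matrix.mul_assoc, hM', ← Matrix.mul_assoc, hM, Matrix.mul_assoc])
  have hcc : c = c' := by
    have h : M * (Mᴴ * M) = (M * Mᴴ) * M := by rw [Matrix.mul_assoc]
    rw [hc, hc'] at h
    simp only [Matrix.mul_smul, Matrix.mul_one, Matrix.smul_mul, Matrix.one_mul] at h
    exact smul_left_injective _ h0 h
  subst hcc
  obtain ⟨i, j, hij⟩ : ∃ i j, M i j ≠ 0 := by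
    by_contra! h
    exact h0 (Matrix.ext h)
  set t : ℝ := ∑ k, ‖M k j‖ ^ 2 with ht
  have htc : c = (t : ℂ) := by
    have := congrFun (congrFun hc j) j
    simp only [Matrix.mul_apply, Matrix.conjTranspose_apply, Matrix.smul_apply, Matrix.one_apply_eq,
      smul_eq_mul, mul_one, RCLike.star_def] at this
    rw [← this, ht]
    push_cast
    exact Finset.sum_congr rfl fun k _ => by rw [mul_comm, Complex.mul_conj']
  have htpos : 0 < t :=
    Finset.sum_pos' (fun _ _ => by positivity) ⟨i, Finset.mem_univ _, by positivity⟩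
  have hs : ((Real.sqrt t : ℂ))⁻¹ * ((Real.sqrt t : ℂ))⁻¹ * c = 1 := by
    rw [htc]
    norm_cast
    have := Real.mul_self_sqrt htpos.le
    have h3 : Real.sqrt t ≠ 0 := (Real.sqrt_pos.2 htpos).ne'
    rw [← mul_inv, this, inv_mul_cancel₀ htpos.ne']
  refine ⟨((Real.sqrt t : ℂ))⁻¹ • M, ?_, ?_, fun x => ?_⟩
  · simp only [Matrix.conjTranspose_smul, Matrix.smul_mul, Matrix.mul_smul, hc, smul_smul]
    rw [show star ((Real.sqrt t : ℂ))⁻¹ = ((Real.sqrt t : ℂ))⁻¹ by simp, ← mul_assoc, hs, one_smul]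
  · simp only [Matrix.conjTranspose_smul, Matrix.smul_mul, Matrix.mul_smul, hc', smul_smul]
    rw [show star ((Real.sqrt t : ℂ))⁻¹ = ((Real.sqrt t : ℂ))⁻¹ by simp, ← mul_assoc, hs, one_smul]
  · rw [Matrix.smul_mul, hM, Matrix.mul_smul]

end IrrepMatrix

variable [IsTopologicalGroup G] [CompactSpace G] [MeasurableSpace G] [BorelSpace G]

theorem integrable_of_continuous {X F : Type*} [TopologicalSpace X] [CompactSpace X]
    [MeasurableSpace X] [OpensMeasurableSpace X] [NormedAddCommGroup F]
    {μ : Measure X} [IsFiniteMeasure μ]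
    {f : X → F} [SecondCountableTopologyEither X F] (hf : Continuous f) : Integrable f μ := by
  obtain ⟨C, hC⟩ := isCompact_univ.exists_bound_of_continuousOn hf.continuousOn
  exact Integrable.of_bound hf.aestronglyMeasurable C (ae_of_all _ fun x => hC x trivial)

variable (μ : Measure G) [IsProbabilityMeasure μ] [μ.IsMulLeftInvariant]

/-- The average `∫ η(x) E_{jl} ξ(x)^* dx` of a matrix unit. -/
noncomputable def IrrepMatrix.average (ξ η : IrrepMatrix G) (j : Fin η.dim) (l : Fin ξ.dim) :
    Matrix (Fin η.dim) (Fin ξ.dim) ℂ :=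
  Matrix.of fun i k => ∫ x, η.mat x i j * star (ξ.mat x k l) ∂μ

theorem IrrepMatrix.average_intertwines (ξ η : IrrepMatrix G) (j : Fin η.dim) (l : Fin ξ.dim)
    (y : G) : IrrepMatrix.average μ ξ η j l * ξ.mat y = η.mat y * IrrepMatrix.average μ ξ η j l := by
  have hint : ∀ (i : Fin η.dim) (k : Fin ξ.dim),
      Integrable (fun x => η.mat x i j * star (ξ.mat x k l)) μ := fun i k =>
    integrable_of_continuous ((η.continuous_mat_apply i j).mul (ξ.continuous_mat_apply k l).star)
  have key : IrrepMatrix.average μ ξ η j l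
      = η.mat y * IrrepMatrix.average μ ξ η j l * (ξ.mat y)ᴴ := by
    ext i k
    simp only [IrrepMatrix.average, Matrix.of_apply, Matrix.mul_apply, Matrix.conjTranspose_apply]
    rw [← integral_mul_left_eq_self _ y]
    simp only [ξ.mat_mul, η.mat_mul, Matrix.mul_apply, star_sum, star_mul']
    simp_rw [Finset.sum_mul_sum]
    rw [integral_finsetSum]
    · simp_rw [Finset.sum_mul]
      rw [Finset.sum_comm]
      refine Finset.sum_congr rfl fun a _ => ?_
      rw [integral_finsetSum]
      · refine Finset.sum_congr rfl fun b _ => ?_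
        rw [← integral_const_mul, ← integral_mul_const]
        congr 1; ext x; ring
      · intro b _
        refine ((hint a b).const_mul (η.mat y i a * star (ξ.mat y k b))).congr (ae_of_all _ ?_)
        intro x; simp only; ring
    · intro a _
      refine integrable_finsetSum _ fun b _ => ?_
      refine ((hint a b).const_mul (η.mat y i a * star (ξ.mat y k b))).congr (ae_of_all _ ?_)
      intro x; simp only; ring
  conv_lhs => rw [key]
  rw [Matrix.mul_assoc, ξ.conjTranspose_mul_mat, Matrix.mul_one]

theorem integral_mat_mul_star_of_not_equivalent (ξ η : IrrepMatrix G) (h : ¬ ξ.Equivalent η)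
    (i j : Fin η.dim) (k l : Fin ξ.dim) : ∫ x, η.mat x i j * star (ξ.mat x k l) ∂μ = 0 := by
  by_contra h0
  refine h (ξ.equivalent_of_intertwiner η (IrrepMatrix.average μ ξ η j l)
    (ξ.average_intertwines μ η j l) fun h1 => h0 ?_)
  exact congrFun (congrFun h1 i) k

theorem integral_mat_mul_star (ξ : IrrepMatrix G) (i j k l : Fin ξ.dim) :
    ∫ x, ξ.mat x i j * star (ξ.mat x k l) ∂μ
      = if i = k ∧ j = l then ((ξ.dim : ℂ))⁻¹ else 0 := by
  obtain ⟨c, hc⟩ := ξ.eq_smul_one_of_commute _ (ξ.average_intertwines μ ξ j l)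
  have h1 : ∀ i k, ∫ x, ξ.mat x i j * star (ξ.mat x k l) ∂μ = c * (if i = k then 1 else 0) := by
    intro i k
    have := congrFun (congrFun hc i) k
    simpa [IrrepMatrix.average, Matrix.one_apply] using this
  have hd : (ξ.dim : ℂ) ≠ 0 := by exact_mod_cast ξ.dim_pos.ne'
  have htr : (ξ.dim : ℂ) * c = if j = l then 1 else 0 := by
    calc (ξ.dim : ℂ) * c = ∑ i : Fin ξ.dim, ∫ x, ξ.mat x i j * star (ξ.mat x i l) ∂μ := by
          simp only [h1, if_true, mul_one, Finset.sum_const, Finset.card_univ, Fintype.card_fin,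
            nsmul_eq_mul]
      _ = ∫ x, ((ξ.mat x)ᴴ * ξ.mat x) l j ∂μ := by
          rw [← integral_finsetSum]
          · simp only [Matrix.mul_apply, Matrix.conjTranspose_apply]
            simp_rw [mul_comm]
          · intro i _
            exact integrable_of_continuous
              ((ξ.continuous_mat_apply i j).mul (ξ.continuous_mat_apply i l).star)
      _ = _ := by
          simp [ξ.conjTranspose_mul_mat, Matrix.one_apply, eq_comm]
  rw [h1]
  by_cases hj : j = l
  · rw [if_pos hj] at htr
    have : c = (ξ.dim : ℂ)⁻¹ := eq_inv_of_mul_eq_one_right htr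
    simp [hj, this]
  · rw [if_neg hj] at htr
    have : c = 0 := by simpa [hd] using htr
    simp [hj, this]

end Schur

/-! ### Integral operators with continuous kernel -/

section Compact

variable {X H : Type*} [TopologicalSpace X] [CompactSpace X] [NormedAddCommGroup H]
  [InnerProductSpace ℂ H]

/-- The operator `h ↦ (x ↦ ⟪κ x, h⟫)` from a Hilbert space to continuous functions. -/
noncomputable def innerOp (κ : C(X, H)) : H →L[ℂ] C(X, ℂ) :=
  LinearMap.mkContinuous
    { toFun := fun h => ⟨fun x => inner ℂ (κ x) h, by fun_prop⟩
      map_add' := fun a b => by ext x; simp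
      map_smul' := fun c a => by ext x; simp } ‖κ‖ (fun h => by
    rw [ContinuousMap.norm_le _ (by positivity)]
    intro x
    exact (norm_inner_le_norm _ _).trans
      (mul_le_mul_of_nonneg_right (κ.norm_coe_le_norm x) (norm_nonneg _)))

@[simp] theorem innerOp_apply (κ : C(X, H)) (h : H) (x : X) : innerOp κ h x = inner ℂ (κ x) h := rfl

theorem isCompactOperator_innerOp (κ : C(X, H)) : IsCompactOperator (innerOp κ) := by
  let A : Set (BoundedContinuousFunction X ℂ) :=
    (fun h => BoundedContinuousFunction.mkOfCompact (innerOp κ h)) '' Metric.closedBall 0 1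
  have hA : IsCompact (closure A) := by
    refine BoundedContinuousFunction.arzela_ascoli (Metric.closedBall 0 ‖κ‖)
      (isCompact_closedBall _ _) A ?_ ?_
    · rintro _ x ⟨h, hh, rfl⟩
      rw [mem_closedBall_zero_iff] at hh ⊢
      calc ‖inner ℂ (κ x) h‖ ≤ ‖κ x‖ * ‖h‖ := norm_inner_le_norm _ _
        _ ≤ ‖κ‖ * 1 := by gcongr; exact κ.norm_coe_le_norm x
        _ = ‖κ‖ := mul_one _
    · intro x₀
      rw [Metric.equicontinuousAt_iff_right]
      intro ε hε
      filter_upwards [Metric.continuousAt_iff'.1 (κ.continuous.continuousAt (x := x₀)) ε hε]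
      rintro x hx ⟨_, h, hh, rfl⟩
      rw [mem_closedBall_zero_iff] at hh
      rw [dist_comm] at hx
      simp only [BoundedContinuousFunction.mkOfCompact_apply, innerOp_apply, dist_eq_norm] at hx ⊢
      rw [← inner_sub_left]
      calc ‖inner ℂ (κ x₀ - κ x) h‖ ≤ ‖κ x₀ - κ x‖ * ‖h‖ := norm_inner_le_norm _ _
        _ ≤ ‖κ x₀ - κ x‖ * 1 := by gcongr
        _ < ε := by rwa [mul_one]
  refine ⟨(ContinuousMap.isometryEquivBoundedOfCompact X ℂ).symm '' closure A,
    hA.image (ContinuousMap.isometryEquivBoundedOfCompact X ℂ).symm.continuous, ?_⟩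
  filter_upwards [Metric.closedBall_mem_nhds (0 : H) one_pos] with h hh
  exact ⟨_, subset_closure ⟨h, hh, rfl⟩, by ext; rfl⟩

end Compact

section PeterWeyl

variable {G : Type*} [Group G] [TopologicalSpace G] [IsTopologicalGroup G] [CompactSpace G]
  [MeasurableSpace G] [BorelSpace G]

theorem isMulRightInvariant_of_compactSpace (μ : Measure G) [μ.IsHaarMeasure]
    [IsProbabilityMeasure μ] : μ.IsMulRightInvariant := by
  refine ⟨fun g => ?_⟩
  have : IsProbabilityMeasure (μ.map (· * g)) :=
    Measure.isProbabilityMeasure_map (measurable_mul_const g).aemeasurable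
  exact Measure.isHaarMeasure_eq_of_isProbabilityMeasure _ _

/-- The continuous family `x ↦ (z ↦ conj (φ (x z⁻¹)))`. -/
noncomputable def convFamily (φ : C(G, ℂ)) : C(G, C(G, ℂ)) :=
  ContinuousMap.curry ⟨fun p => star (φ (p.1 * p.2⁻¹)), by fun_prop⟩

@[simp] theorem convFamily_apply (φ : C(G, ℂ)) (x z : G) :
    convFamily φ x z = star (φ (x * z⁻¹)) := rfl

/-- Right translations `g ↦ f(· g)`, as a continuous family. -/
noncomputable def translate (f : C(G, ℂ)) : C(G, C(G, ℂ)) :=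
  ContinuousMap.curry ⟨fun p => f (p.2 * p.1), by fun_prop⟩

@[simp] theorem translate_apply (f : C(G, ℂ)) (g x : G) : translate f g x = f (x * g) := rfl

variable (μ : Measure G) [IsProbabilityMeasure μ]

/-- The operator `h ↦ (x ↦ ∫ φ(x z⁻¹) h(z) dz)` from `L²` to continuous functions. -/
noncomputable def convOp (φ : C(G, ℂ)) : Lp ℂ 2 μ →L[ℂ] C(G, ℂ) :=
  innerOp ⟨fun x => ContinuousMap.toLp 2 μ ℂ (convFamily φ x),
    (ContinuousMap.toLp 2 μ ℂ).continuous.comp (convFamily φ).continuous⟩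

theorem inner_toLp_left (f : C(G, ℂ)) (h : Lp ℂ 2 μ) :
    inner ℂ (ContinuousMap.toLp 2 μ ℂ f) h = ∫ x, star (f x) * h x ∂μ := by
  rw [L2.inner_def]
  refine integral_congr_ae ?_
  filter_upwards [ContinuousMap.coeFn_toLp (p := 2) (𝕜 := ℂ) μ f] with x hx
  rw [hx, RCLike.inner_apply, mul_comm]
  rfl

theorem convOp_apply (φ : C(G, ℂ)) (h : Lp ℂ 2 μ) (x : G) :
    convOp μ φ h x = ∫ z, φ (x * z⁻¹) * h z ∂μ := by
  change inner ℂ (ContinuousMap.toLp 2 μ ℂ (convFamily φ x)) h = _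
  rw [inner_toLp_left]
  simp

theorem convOp_toLp_apply (φ f : C(G, ℂ)) (x : G) :
    convOp μ φ (ContinuousMap.toLp 2 μ ℂ f) x = ∫ z, φ (x * z⁻¹) * f z ∂μ := by
  rw [convOp_apply]
  refine integral_congr_ae ?_
  filter_upwards [ContinuousMap.coeFn_toLp (p := 2) (𝕜 := ℂ) μ f] with z hz
  rw [hz]

/-- Convolution with `φ` as an operator on `L²`. -/
noncomputable def convL2 (φ : C(G, ℂ)) : Lp ℂ 2 μ →L[ℂ] Lp ℂ 2 μ :=
  (ContinuousMap.toLp 2 μ ℂ).comp (convOp μ φ)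

theorem isCompactOperator_convL2 (φ : C(G, ℂ)) : IsCompactOperator (convL2 μ φ) :=
  (isCompactOperator_innerOp _).clm_comp (ContinuousMap.toLp 2 μ ℂ)

theorem isSymmetric_convL2 [SecondCountableTopology G] (φ : C(G, ℂ))
    (hφ : ∀ x, φ x⁻¹ = star (φ x)) : (convL2 μ φ : Lp ℂ 2 μ →ₗ[ℂ] Lp ℂ 2 μ).IsSymmetric := by
  intro h g
  have hh : Integrable h μ := (Lp.memLp h).integrable (by norm_num)
  have hg : Integrable g μ := (Lp.memLp g).integrable (by norm_num)
  have e1 : inner ℂ (convL2 μ φ h) g = ∫ x, ∫ z, star (φ (x * z⁻¹)) * star (h z) * g x ∂μ ∂μ := by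
    change inner ℂ (ContinuousMap.toLp 2 μ ℂ (convOp μ φ h)) g = _
    rw [inner_toLp_left]
    refine integral_congr_ae (ae_of_all _ fun x => ?_)
    simp only
    rw [integral_mul_const, convOp_apply, RCLike.star_def, ← integral_conj]
    simp
  have e2 : inner ℂ h (convL2 μ φ g) = ∫ z, ∫ x, star (φ (x * z⁻¹)) * star (h z) * g x ∂μ ∂μ := by
    rw [← inner_conj_symm]
    change (starRingEnd ℂ) (inner ℂ (ContinuousMap.toLp 2 μ ℂ (convOp μ φ g)) h) = _
    rw [inner_toLp_left, ← integral_conj]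
    refine integral_congr_ae (ae_of_all _ fun z => ?_)
    simp only [map_mul, RCLike.star_def, Complex.conj_conj]
    rw [convOp_apply, ← integral_mul_const]
    refine integral_congr_ae (ae_of_all _ fun x => ?_)
    have := hφ (x * z⁻¹)
    rw [mul_inv_rev, inv_inv] at this
    simp only [this, RCLike.star_def]
    ring
  change inner ℂ (convL2 μ φ h) g = inner ℂ h (convL2 μ φ g)
  rw [e1, e2]
  refine integral_integral_swap ?_
  obtain ⟨C, hC⟩ := isCompact_univ.exists_bound_of_continuousOn φ.continuous.continuousOn
  have hb : Integrable (fun p : G × G => g p.1 * star (h p.2)) (μ.prod μ) :=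
    hg.mul_prod (g := fun z => star (h z)) (Complex.conjCLE.toContinuousLinearMap.integrable_comp hh)
  refine (hb.bdd_mul (c := C) (f := fun p : G × G => star (φ (p.1 * p.2⁻¹))) ?_ ?_).congr ?_
  · exact Continuous.aestronglyMeasurable (by fun_prop)
  · exact ae_of_all _ fun p => by rw [norm_star]; exact hC _ trivial
  · exact ae_of_all _ fun p => by simp only [Function.uncurry]; ring

end PeterWeyl

/-! ### The Peter–Weyl theorem -/

section PeterWeyl

variable {G : Type*} [Group G] [TopologicalSpace G] [IsTopologicalGroup G] [CompactSpace G]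
  [MeasurableSpace G] [BorelSpace G]

/-- The matrix coefficient `ξᵢⱼ` as a continuous function. -/
def IrrepMatrix.coeff (ξ : IrrepMatrix G) (i j : Fin ξ.dim) : C(G, ℂ) :=
  ⟨fun x => ξ.mat x i j, ξ.continuous_mat_apply i j⟩

@[simp] theorem IrrepMatrix.coeff_apply (ξ : IrrepMatrix G) (i j : Fin ξ.dim) (x : G) :
    ξ.coeff i j x = ξ.mat x i j := rfl

variable (G) in
/-- The span of all matrix coefficients of irreducible unitary representations. -/
noncomputable def coeffSpan : Submodule ℂ C(G, ℂ) :=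
  Submodule.span ℂ {f | ∃ (ξ : IrrepMatrix G) (i j : Fin ξ.dim), f = ξ.coeff i j}

theorem translate_smul (c : ℂ) (f : C(G, ℂ)) (g : G) :
    translate (c • f) g = c • translate f g := by ext; simp

theorem translate_mul (f : C(G, ℂ)) (g h : G) :
    translate f (g * h) = translate (translate f h) g := by ext; simp [mul_assoc]

theorem translate_one (f : C(G, ℂ)) : translate f 1 = f := by ext; simp

theorem translate_sum {ι : Type*} (s : Finset ι) (f : ι → C(G, ℂ)) (g : G) :
    translate (∑ i ∈ s, f i) g = ∑ i ∈ s, translate (f i) g := by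
  ext; simp [ContinuousMap.sum_apply]

variable (μ : Measure G) [IsProbabilityMeasure μ] [μ.IsHaarMeasure]

theorem inner_toLp_translate (f h : C(G, ℂ)) (g : G) :
    inner ℂ (ContinuousMap.toLp 2 μ ℂ (translate f g)) (ContinuousMap.toLp 2 μ ℂ (translate h g))
      = inner ℂ (ContinuousMap.toLp 2 μ ℂ f) (ContinuousMap.toLp 2 μ ℂ h) := by
  have := isMulRightInvariant_of_compactSpace μ
  rw [ContinuousMap.inner_toLp, ContinuousMap.inner_toLp]
  exact integral_mul_right_eq_self (fun x => h x * (starRingEnd ℂ) (f x)) g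

/-- An `L²`-orthonormal basis of a finite-dimensional space of continuous functions. -/
theorem exists_orthonormal_basis (V : Submodule ℂ C(G, ℂ)) [FiniteDimensional ℂ V] {n : ℕ}
    (hV : Module.finrank ℂ V = n) : ∃ e : Fin n → C(G, ℂ), (∀ i, e i ∈ V) ∧
      (∀ i j, inner ℂ (ContinuousMap.toLp 2 μ ℂ (e i)) (ContinuousMap.toLp 2 μ ℂ (e j))
        = if i = j then (1 : ℂ) else 0) ∧
      ∀ f ∈ V, f = ∑ i, (inner ℂ (ContinuousMap.toLp 2 μ ℂ (e i))
        (ContinuousMap.toLp 2 μ ℂ f) : ℂ) • e i := by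
  let L : C(G, ℂ) →ₗ[ℂ] Lp ℂ 2 μ := (ContinuousMap.toLp 2 μ ℂ).toLinearMap
  have hL : Function.Injective L := ContinuousMap.toLp_injective μ
  let W := V.map L
  have hn : Module.finrank ℂ W = n :=
    (V.equivMapOfInjective L hL).finrank_eq.symm.trans hV
  let b : OrthonormalBasis (Fin n) ℂ W :=
    (stdOrthonormalBasis ℂ W).reindex (finCongr hn)
  have hb : ∀ i, ∃ f ∈ V, L f = b i := fun i => (b i).2
  choose e he1 he2 using hb
  refine ⟨e, he1, fun i j => ?_, fun f hf => hL ?_⟩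
  · change inner ℂ (L (e i)) (L (e j)) = _
    rw [he2, he2, ← Submodule.coe_inner, orthonormal_iff_ite.1 b.orthonormal]
  · rw [map_sum]
    have h := congrArg Subtype.val (b.sum_repr' ⟨L f, f, hf, rfl⟩)
    simp only [Submodule.coe_sum, Submodule.coe_smul, Submodule.coe_inner] at h
    rw [← h]
    refine Finset.sum_congr rfl fun i _ => ?_
    rw [map_smul, ← he2]
    rfl

/-- A finite-dimensional right-invariant space of continuous functions is spanned by matrix
coefficients of irreducible representations. -/
theorem le_coeffSpan_of_translate_mem (μ : Measure G) [IsProbabilityMeasure μ] [μ.IsHaarMeasure]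
    (n : ℕ) : ∀ (V : Submodule ℂ C(G, ℂ)) [FiniteDimensional ℂ V],
    Module.finrank ℂ V = n → (∀ g, ∀ f ∈ V, translate f g ∈ V) → V ≤ coeffSpan G := by
  induction n using Nat.strong_induction_on with
  | _ n ih =>
  intro V _ hn hV
  obtain ⟨e, heV, hon, hexp⟩ := exists_orthonormal_basis μ V hn
  let L : C(G, ℂ) →ₗ[ℂ] Lp ℂ 2 μ := (ContinuousMap.toLp 2 μ ℂ).toLinearMap
  rcases Nat.eq_zero_or_pos n with h0 | hpos
  · rw [Submodule.finrank_eq_zero.1 (hn.trans h0)]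
    exact bot_le
  let P : G → Matrix (Fin n) (Fin n) ℂ := fun g =>
    Matrix.of fun i j => inner ℂ (L (e i)) (L (translate (e j) g))
  have hP : ∀ g j, translate (e j) g = ∑ i, P g i j • e i := fun g j =>
    hexp _ (hV g _ (heV j))
  have hPmul : ∀ g h, P (g * h) = P g * P h := by
    intro g h
    ext i j
    rw [Matrix.mul_apply]
    change inner ℂ (L (e i)) (L (translate (e j) (g * h))) = _
    rw [translate_mul, hP h j, translate_sum, map_sum, inner_sum]
    refine Finset.sum_congr rfl fun k _ => ?_
    rw [translate_smul, map_smul, inner_smul_right, mul_comm]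
    rfl
  have hPone : P 1 = 1 := by
    ext i j
    change inner ℂ (L (e i)) (L (translate (e j) 1)) = _
    rw [translate_one, Matrix.one_apply]
    exact hon i j
  have hPunit : ∀ g, star (P g) * P g = 1 := by
    intro g
    ext i j
    have h1 : inner ℂ (L (translate (e i) g)) (L (translate (e j) g)) = if i = j then (1 : ℂ) else 0 :=
      (inner_toLp_translate μ (e i) (e j) g).trans (hon i j)
    rw [Matrix.one_apply, ← h1, hP g i, map_sum, sum_inner, Matrix.mul_apply]
    refine Finset.sum_congr rfl fun k _ => ?_
    rw [map_smul, inner_smul_left]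
    rfl
  let ρ : G →* Matrix.unitaryGroup (Fin n) ℂ :=
    { toFun := fun g => ⟨P g, Matrix.mem_unitaryGroup_iff'.2 (hPunit g)⟩
      map_one' := Subtype.ext hPone
      map_mul' := fun g h => Subtype.ext (hPmul g h) }
  have hρcont : Continuous ρ := by
    refine Continuous.subtype_mk (continuous_matrix fun i j => ?_) _
    have h1 : Continuous fun g => L (translate (e j) g) :=
      (ContinuousMap.toLp 2 μ ℂ).continuous.comp (translate (e j)).continuous
    exact continuous_const.inner h1
  by_cases hirr : (matrixRep ρ).IsIrreducible
  · let η : IrrepMatrix G := ⟨n, ρ, hρcont, hirr⟩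
    have he : ∀ j, e j ∈ coeffSpan G := by
      intro j
      have : e j = ∑ i, e i 1 • η.coeff i j := by
        ext x
        have := congrArg (fun f : C(G, ℂ) => f 1) (hP x j)
        simp only [translate_apply, one_mul, ContinuousMap.sum_apply, ContinuousMap.smul_apply,
          smul_eq_mul] at this
        rw [this, ContinuousMap.sum_apply]
        exact Finset.sum_congr rfl fun i _ => mul_comm _ _
      rw [this]
      exact Submodule.sum_mem _ fun i _ => Submodule.smul_mem _ _
        (Submodule.subset_span ⟨η, i, j, rfl⟩)
    intro f hf
    rw [hexp f hf]
    exact Submodule.sum_mem _ fun i _ => Submodule.smul_mem _ _ (he i)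
  · have hS : ∃ S : Subrepresentation (matrixRep ρ), S ≠ ⊥ ∧ S ≠ ⊤ := by
      by_contra! hS
      apply hirr
      have : Nonempty (Fin n) := ⟨⟨0, hpos⟩⟩
      have hnt : Nontrivial (Subrepresentation (matrixRep ρ)) := by
        refine ⟨⊥, ⊤, fun h => ?_⟩
        have h2 : (⊥ : Submodule ℂ (Fin n → ℂ)) = ⊤ :=
          congrArg Subrepresentation.toSubmodule h
        exact bot_ne_top h2
      exact ⟨fun a => or_iff_not_imp_left.2 (hS a)⟩
    obtain ⟨S, hS0, hS1⟩ := hS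
    have hS0' : S.toSubmodule ≠ ⊥ := fun h =>
      hS0 (Subrepresentation.toSubmodule_injective h)
    have hS1' : S.toSubmodule ≠ ⊤ := fun h =>
      hS1 (Subrepresentation.toSubmodule_injective h)
    let T : (Fin n → ℂ) →ₗ[ℂ] C(G, ℂ) := Fintype.linearCombination ℂ e
    have hT : ∀ c, T c = ∑ i, c i • e i := fun c => Fintype.linearCombination_apply ℂ e c
    have hTinj : Function.Injective T := by
      rw [← LinearMap.ker_eq_bot, LinearMap.ker_eq_bot']
      intro c hc
      funext i
      have h1 : inner ℂ (L (e i)) (L (T c)) = c i := by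
        rw [hT, map_sum, inner_sum]
        simp_rw [map_smul, inner_smul_right]
        have : ∀ j, inner ℂ (L (e i)) (L (e j)) = if i = j then (1 : ℂ) else 0 := hon i
        simp [this]
      rw [← h1, hc, map_zero, inner_zero_right]
      rfl
    let F := S.toSubmodule.map T
    have hFV : F ≤ V := by
      rintro _ ⟨c, _, rfl⟩
      rw [hT]
      exact Submodule.sum_mem _ fun i _ => Submodule.smul_mem _ _ (heV i)
    have hFinv : ∀ g, ∀ f ∈ F, translate f g ∈ F := by
      rintro g _ ⟨c, hc, rfl⟩
      refine ⟨P g *ᵥ c, ?_, ?_⟩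
      · have := S.apply_mem_toSubmodule g hc
        simpa [matrixRep, ρ] using this
      · rw [hT, hT, translate_sum]
        simp_rw [translate_smul, hP, Matrix.mulVec, dotProduct, Finset.sum_smul, Finset.smul_sum]
        rw [Finset.sum_comm]
        simp_rw [smul_smul, mul_comm]
    have hFrank : Module.finrank ℂ F < n := by
      have h1 : Module.finrank ℂ F = Module.finrank ℂ S.toSubmodule :=
        ((S.toSubmodule).equivMapOfInjective T hTinj).finrank_eq.symm
      rw [h1]
      have := Submodule.finrank_lt hS1'
      simpa using this
    have : FiniteDimensional ℂ F := Submodule.finiteDimensional_of_le hFV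
    let F' := V ⊓ ((F.map L)ᗮ).comap L
    have hF'V : F' ≤ V := inf_le_left
    have : FiniteDimensional ℂ F' := Submodule.finiteDimensional_of_le hF'V
    have hF'inv : ∀ g, ∀ f ∈ F', translate f g ∈ F' := by
      rintro g f ⟨hf1, hf2⟩
      refine ⟨hV g f hf1, ?_⟩
      refine Submodule.mem_comap.2 ((Submodule.mem_orthogonal _ _).2 ?_)
      rintro _ ⟨u, hu, rfl⟩
      have h1 : u = translate (translate u g⁻¹) g := by
        rw [← translate_mul, mul_inv_cancel, translate_one]
      rw [h1]
      refine (inner_toLp_translate μ (translate u g⁻¹) f g).trans ?_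
      exact (Submodule.mem_orthogonal _ _).1 hf2 _ ⟨_, hFinv g⁻¹ u hu, rfl⟩
    have hF'rank : Module.finrank ℂ F' < n := by
      rw [← hn]
      refine Submodule.finrank_lt_finrank_of_lt (lt_of_le_of_ne hF'V fun h => ?_)
      obtain ⟨c, hc, hc0⟩ := Submodule.exists_mem_ne_zero_of_ne_bot hS0'
      have hu : T c ∈ F := ⟨c, hc, rfl⟩
      have hu' : T c ∈ F' := h ▸ hFV hu
      have h2 : inner ℂ (L (T c)) (L (T c)) = (0 : ℂ) :=
        (Submodule.mem_orthogonal _ _).1 hu'.2 _ ⟨_, hu, rfl⟩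
      rw [inner_self_eq_zero] at h2
      have h3 : T c = 0 := ContinuousMap.toLp_injective (p := 2) (𝕜 := ℂ) μ (by rw [map_zero]; exact h2)
      exact hc0 (hTinj (by rw [h3, map_zero]))
    intro f hf
    obtain ⟨y, ⟨u, hu, rfl⟩, z, hz, hyz⟩ :=
      Submodule.exists_add_mem_mem_orthogonal (K := F.map L) (L f)
    have hfu : f - u ∈ F' := by
      refine ⟨V.sub_mem hf (hFV hu), ?_⟩
      refine Submodule.mem_comap.2 ?_
      rw [map_sub, hyz, add_sub_cancel_left]
      exact hz
    have h1 := ih _ hFrank F rfl hFinv hu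
    have h2 := ih _ hF'rank F' rfl hF'inv hfu
    simpa using Submodule.add_mem _ h2 h1

/-- Eigenvectors of convolution operators are spanned by matrix coefficients. -/
theorem eigenspace_convL2_le (φ : C(G, ℂ)) (l : ℂ) (hl : l ≠ 0) :
    Module.End.eigenspace (convL2 μ φ : Lp ℂ 2 μ →ₗ[ℂ] Lp ℂ 2 μ) l
      ≤ (coeffSpan G).map (ContinuousMap.toLp 2 μ ℂ).toLinearMap := by
  have hright := isMulRightInvariant_of_compactSpace μ
  let L : C(G, ℂ) →ₗ[ℂ] Lp ℂ 2 μ := (ContinuousMap.toLp 2 μ ℂ).toLinearMap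
  have hL : Function.Injective L := ContinuousMap.toLp_injective μ
  let V : Submodule ℂ C(G, ℂ) :=
    LinearMap.ker ((convOp μ φ).toLinearMap ∘ₗ L - l • LinearMap.id)
  have hVmem : ∀ f, f ∈ V ↔ convOp μ φ (ContinuousMap.toLp 2 μ ℂ f) = l • f := by
    intro f
    rw [LinearMap.mem_ker, LinearMap.sub_apply, sub_eq_zero]
    rfl
  have hfin : FiniteDimensional ℂ (Module.End.eigenspace (convL2 μ φ : Lp ℂ 2 μ →ₗ[ℂ] Lp ℂ 2 μ) l) :=
    ContinuousLinearMap.finite_dimensional_eigenspace (isCompactOperator_convL2 μ φ) l hl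
  have hle : V.map L ≤ Module.End.eigenspace (convL2 μ φ : Lp ℂ 2 μ →ₗ[ℂ] Lp ℂ 2 μ) l := by
    rintro _ ⟨f, hf, rfl⟩
    rw [Module.End.mem_eigenspace_iff]
    change ContinuousMap.toLp 2 μ ℂ (convOp μ φ (ContinuousMap.toLp 2 μ ℂ f)) = _
    rw [(hVmem f).1 hf, map_smul]
    rfl
  have : FiniteDimensional ℂ (V.map L) := Submodule.finiteDimensional_of_le hle
  have : FiniteDimensional ℂ V := (V.equivMapOfInjective L hL).symm.finiteDimensional
  have hVinv : ∀ g, ∀ f ∈ V, translate f g ∈ V := by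
    intro g f hf
    rw [hVmem] at hf ⊢
    ext x
    rw [convOp_toLp_apply]
    have h1 := congrArg (fun u : C(G, ℂ) => u (x * g)) hf
    simp only [convOp_toLp_apply] at h1
    rw [← integral_mul_right_eq_self _ g] at h1
    simpa [mul_assoc] using h1
  have hVc := le_coeffSpan_of_translate_mem μ _ V rfl hVinv
  intro h hh
  rw [Module.End.mem_eigenspace_iff] at hh
  have hh' : L (l⁻¹ • convOp μ φ h) = h := by
    rw [map_smul]
    change l⁻¹ • (convL2 μ φ h) = h
    rw [show convL2 μ φ h = l • h from hh, smul_smul, inv_mul_cancel₀ hl, one_smul]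
  refine ⟨l⁻¹ • convOp μ φ h, hVc ((hVmem _).2 ?_), hh'⟩
  rw [show ContinuousMap.toLp 2 μ ℂ (l⁻¹ • convOp μ φ h) = h from hh', smul_smul,
    mul_inv_cancel₀ hl, one_smul]

variable [SecondCountableTopology G] [T2Space G]

/-- The **Peter–Weyl theorem**: matrix coefficients of irreducible representations have dense span
in `L²`. -/
theorem orthogonal_coeffSpan_eq_bot :
    ((coeffSpan G).map (ContinuousMap.toLp 2 μ ℂ).toLinearMap)ᗮ = ⊥ := by
  rw [eq_bot_iff]
  intro h hh
  rw [Submodule.mem_bot]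
  have hsym : ∀ φ : C(G, ℂ), (∀ x, φ x⁻¹ = star (φ x)) → convOp μ φ h = 0 := by
    intro φ hφ
    have hs := isSymmetric_convL2 μ φ hφ
    have h1 : convL2 μ φ h ∈
        (⨆ l, Module.End.eigenspace (convL2 μ φ : Lp ℂ 2 μ →ₗ[ℂ] Lp ℂ 2 μ) l)ᗮ := by
      rw [← Submodule.iInf_orthogonal, Submodule.mem_iInf]
      intro l
      rw [Submodule.mem_orthogonal]
      intro v hv
      have h2 : inner ℂ (convL2 μ φ v) h = inner ℂ v (convL2 μ φ h) := hs v h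
      rw [← h2, show convL2 μ φ v = l • v from Module.End.mem_eigenspace_iff.1 hv]
      rcases eq_or_ne l 0 with rfl | hl
      · rw [zero_smul, inner_zero_left]
      · rw [inner_smul_left, (Submodule.mem_orthogonal _ _).1 hh v (eigenspace_convL2_le μ φ l hl hv),
          mul_zero]
    rw [ContinuousLinearMap.orthogonalComplement_iSup_eigenspaces_eq_bot
      (isCompactOperator_convL2 μ φ) hs, Submodule.mem_bot] at h1
    exact ContinuousMap.toLp_injective (p := 2) (𝕜 := ℂ) μ (h1.trans (map_zero _).symm)
  have hint : ∀ φ : C(G, ℂ), Integrable (fun z => φ z⁻¹ * h z) μ := by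
    intro φ
    obtain ⟨C, hC⟩ := isCompact_univ.exists_bound_of_continuousOn φ.continuous.continuousOn
    exact ((Lp.memLp h).integrable (by norm_num)).bdd_mul
      (Continuous.aestronglyMeasurable (by fun_prop)) (ae_of_all _ fun z => hC z⁻¹ trivial)
  have hsym' : ∀ φ : C(G, ℂ), (∀ x, φ x⁻¹ = star (φ x)) → ∫ z, φ z⁻¹ * h z ∂μ = 0 := by
    intro φ hφ
    have h1 := congrArg (fun u : C(G, ℂ) => u 1) (hsym φ hφ)
    simpa [convOp_apply] using h1
  have hall : ∀ φ : C(G, ℂ), ∫ z, φ z⁻¹ * h z ∂μ = 0 := by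
    intro φ
    let φs : C(G, ℂ) := ⟨fun x => star (φ x⁻¹), by fun_prop⟩
    have h1 := hsym' (φ + φs) (fun x => by simp [φs, add_comm])
    have h2 := hsym' (Complex.I • (φ - φs)) (fun x => by simp [φs]; ring)
    simp only [ContinuousMap.add_apply, ContinuousMap.smul_apply, ContinuousMap.sub_apply,
      smul_eq_mul, mul_assoc, add_mul, sub_mul] at h1 h2
    rw [integral_const_mul, integral_sub (hint φ) (hint φs)] at h2
    rw [integral_add (hint φ) (hint φs)] at h1
    have h3 := (mul_eq_zero.1 h2).resolve_left Complex.I_ne_zero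
    linear_combination (h1 + h3) / 2
  have horth : ∀ f : C(G, ℂ), inner ℂ (ContinuousMap.toLp 2 μ ℂ f) h = 0 := by
    intro f
    rw [inner_toLp_left]
    have := hall ⟨fun x => star (f x⁻¹), by fun_prop⟩
    simpa using this
  have hd : DenseRange (ContinuousMap.toLp 2 μ ℂ : C(G, ℂ) →L[ℂ] Lp ℂ 2 μ) :=
    ContinuousMap.toLp_denseRange ℂ μ ℂ (by norm_num)
  exact hd.eq_zero_of_inner_right ℂ horth

end PeterWeyl

section Dual

variable {G : Type*} [Group G] [TopologicalSpace G] [IsTopologicalGroup G] [CompactSpace G]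
  [MeasurableSpace G] [BorelSpace G]

theorem IsChoiceOfRepresentatives.not_equivalent {ξ : UnitaryDual G → IrrepMatrix G}
    (hξ : IsChoiceOfRepresentatives ξ) {c c' : UnitaryDual G} (h : c ≠ c') :
    ¬ (ξ c).Equivalent (ξ c') := fun he =>
  h (by rw [← hξ c, ← hξ c']; exact Quotient.sound he)

theorem IsChoiceOfRepresentatives.coeffSpan_eq {ξ : UnitaryDual G → IrrepMatrix G}
    (hξ : IsChoiceOfRepresentatives ξ) :
    coeffSpan G = Submodule.span ℂ {f | ∃ c i j, f = (ξ c).coeff i j} := by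
  apply le_antisymm
  · refine Submodule.span_le.2 ?_
    rintro _ ⟨η, i, j, rfl⟩
    let c : UnitaryDual G := Quotient.mk (irrepSetoid G) η
    obtain ⟨U, hU1, hU2, hU⟩ : (ξ c).Equivalent η := Quotient.exact (hξ c)
    have : η.coeff i j = ∑ b, ∑ a, (U i a * Uᴴ b j) • (ξ c).coeff a b := by
      ext x
      have h1 : η.mat x = U * (ξ c).mat x * Uᴴ := by
        rw [hU, Matrix.mul_assoc, hU2, Matrix.mul_one]
      rw [IrrepMatrix.coeff_apply, h1, Matrix.mul_apply]
      simp only [ContinuousMap.sum_apply, ContinuousMap.smul_apply, smul_eq_mul,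
        IrrepMatrix.coeff_apply, Matrix.mul_apply, Finset.sum_mul]
      refine Finset.sum_congr rfl fun b _ => Finset.sum_congr rfl fun a _ => by ring
    rw [this]
    exact Submodule.sum_mem _ fun b _ => Submodule.sum_mem _ fun a _ =>
      Submodule.smul_mem _ _ (Submodule.subset_span ⟨c, a, b, rfl⟩)
  · refine Submodule.span_mono ?_
    rintro _ ⟨c, i, j, rfl⟩
    exact ⟨ξ c, i, j, rfl⟩

variable (μ : Measure G) [IsProbabilityMeasure μ] [μ.IsHaarMeasure] [SecondCountableTopology G]

theorem countable_unitaryDual {ξ : UnitaryDual G → IrrepMatrix G}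
    (hξ : IsChoiceOfRepresentatives ξ) (μ : Measure G) [IsProbabilityMeasure μ]
    [μ.IsHaarMeasure] : Countable (UnitaryDual G) := by
  let v : UnitaryDual G → Lp ℂ 2 μ := fun c =>
    ((Real.sqrt (ξ c).dim : ℝ) : ℂ) •
      ContinuousMap.toLp 2 μ ℂ ((ξ c).coeff ⟨0, (ξ c).dim_pos⟩ ⟨0, (ξ c).dim_pos⟩)
  have hv1 : ∀ c, ‖v c‖ ^ 2 = 1 := by
    intro c
    have h0 : (0 : ℝ) < (ξ c).dim := by exact_mod_cast (ξ c).dim_pos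
    have h1 : (inner ℂ (v c) (v c) : ℂ) = 1 := by
      rw [inner_smul_left, inner_smul_right, ContinuousMap.inner_toLp]
      simp only [IrrepMatrix.coeff_apply]
      rw [← RCLike.star_def, integral_mat_mul_star]
      simp only [and_self, if_true]
      rw [Complex.star_def, Complex.conj_ofReal, ← mul_assoc, ← Complex.ofReal_mul, Real.mul_self_sqrt h0.le]
      rw [Complex.ofReal_natCast, mul_inv_cancel₀]
      exact_mod_cast h0.ne'
    rw [inner_self_eq_norm_sq_to_K] at h1
    exact Complex.ofReal_injective (by push_cast; exact h1)
  have hv2 : ∀ c c', c ≠ c' → (inner ℂ (v c) (v c') : ℂ) = 0 := by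
    intro c c' h
    rw [inner_smul_left, inner_smul_right, ContinuousMap.inner_toLp]
    simp only [IrrepMatrix.coeff_apply]
    rw [← RCLike.star_def, integral_mat_mul_star_of_not_equivalent μ _ _ (hξ.not_equivalent h),
      mul_zero, mul_zero]
  have : Fact ((2 : ℝ≥0∞) ≠ ⊤) := ⟨by norm_num⟩
  refine Pairwise.countable_of_isOpen_disjoint (s := fun c => Metric.ball (v c) (1 / 2)) ?_
    (fun _ => Metric.isOpen_ball) (fun c => ⟨v c, Metric.mem_ball_self (by norm_num)⟩)
  intro c c' h
  refine Metric.ball_disjoint_ball ?_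
  have h1 := @norm_sub_sq ℂ _ _ _ _ (v c) (v c')
  rw [hv1, hv1, hv2 c c' h, map_zero] at h1
  rw [dist_eq_norm]
  nlinarith [norm_nonneg (v c - v c')]

theorem exists_mem_coeffSpan_integral_norm_sub_lt [T2Space G] (φ : C(G, ℂ)) {ε : ℝ} (hε : 0 < ε) :
    ∃ p ∈ coeffSpan G, ∫ x, ‖p x - φ x‖ ∂μ < ε := by
  have hd : Dense (((coeffSpan G).map (ContinuousMap.toLp 2 μ ℂ).toLinearMap : Submodule ℂ _) :
      Set (Lp ℂ 2 μ)) :=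
    Submodule.dense_iff_topologicalClosure_eq_top.2
      (Submodule.topologicalClosure_eq_top_iff.2 (orthogonal_coeffSpan_eq_bot μ))
  obtain ⟨_, hdist, p, hp, rfl⟩ := Metric.dense_iff.1 hd (ContinuousMap.toLp 2 μ ℂ φ) ε hε
  refine ⟨p, hp, lt_of_le_of_lt ?_ hdist⟩
  change _ ≤ dist (ContinuousMap.toLp 2 μ ℂ p) (ContinuousMap.toLp 2 μ ℂ φ)
  have hmem : MemLp (p - φ : C(G, ℂ)) 2 μ :=
    MemLp.of_bound (p - φ).continuous.aestronglyMeasurable ‖p - φ‖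
      (ae_of_all _ fun x => (p - φ).norm_coe_le_norm x)
  have h1 : eLpNorm (ContinuousMap.toLp 2 μ ℂ (p - φ)) 2 μ = eLpNorm (p - φ : C(G, ℂ)) 2 μ :=
    eLpNorm_congr_ae (ContinuousMap.coeFn_toLp (p := 2) (𝕜 := ℂ) μ (p - φ))
  rw [dist_eq_norm, ← map_sub, Lp.norm_def, h1]
  change ∫ x, ‖(p - φ : C(G, ℂ)) x‖ ∂μ ≤ _
  rw [integral_norm_eq_lintegral_enorm (p - φ).continuous.aestronglyMeasurable,
    ← eLpNorm_one_eq_lintegral_enorm]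
  refine ENNReal.toReal_mono hmem.eLpNorm_ne_top ?_
  exact eLpNorm_le_eLpNorm_of_exponent_le (by norm_num)
    (p - φ).continuous.aestronglyMeasurable

end Dual

/-! ### Smooth dependence of integrals on parameters -/

section Parametric

variable {E : Type*} [NormedAddCommGroup E] [NormedSpace ℝ E] [FiniteDimensional ℝ E]
  {E' : Type*} [NormedAddCommGroup E'] [NormedSpace ℝ E']
  {H : Type*} [TopologicalSpace H] {J : ModelWithCorners ℝ E' H}
  {M : Type*} [TopologicalSpace M] [ChartedSpace H M] [IsManifold J ∞ M]

theorem contMDiffOn_fderiv_param {F : M → E → ℂ} {U : Set E} (hU : IsOpen U)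
    (hF : ContMDiffOn (J.prod 𝓘(ℝ, E)) 𝓘(ℝ, ℂ) ∞ (Function.uncurry F) (Set.univ ×ˢ U)) :
    ContMDiffOn (J.prod 𝓘(ℝ, E)) 𝓘(ℝ, E →L[ℝ] ℂ) ∞
      (fun p : M × E => fderiv ℝ (F p.1) p.2) (Set.univ ×ˢ U) := by
  rintro ⟨y, u⟩ hu
  have hopen : (Set.univ ×ˢ U : Set (M × E)) ∈ 𝓝 (y, u) :=
    (isOpen_univ.prod hU).mem_nhds hu
  have h1 : ContMDiffAt (J.prod 𝓘(ℝ, E)) 𝓘(ℝ, ℂ) ∞ (Function.uncurry F) (y, u) :=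
    hF.contMDiffAt hopen
  have h2 := ContMDiffAt.mfderiv (I := 𝓘(ℝ, E)) (I' := 𝓘(ℝ, ℂ)) (J := J.prod 𝓘(ℝ, E))
    (x₀ := (y, u)) (n := ∞) (m := ∞) (fun (p : M × E) (w : E) => F p.1 w) (fun p => p.2)
    (h1.comp_of_eq (f := fun q : (M × E) × E => (q.1.1, q.2)) (x := ((y, u), u))
      ((contMDiffAt_fst.comp ((y, u), u) contMDiffAt_fst).prodMk contMDiffAt_snd) rfl)
    contMDiffAt_snd (by simp)
  refine (h2.congr_of_eventuallyEq (Eventually.of_forall fun p => ?_)).contMDiffWithinAt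
  refine Eq.trans ?_ (congrFun (inTangentCoordinates_model_space _ _ _ _) p).symm
  exact (mfderiv_eq_fderiv (f := F p.1)).symm

variable [CompactSpace M] [MeasurableSpace M] [BorelSpace M] [SecondCountableTopology M]
  (μ : Measure M) [IsFiniteMeasure μ]

theorem hasFDerivAt_integral_param {F : M → E → ℂ} {U : Set E} (hU : IsOpen U)
    (hF : ContMDiffOn (J.prod 𝓘(ℝ, E)) 𝓘(ℝ, ℂ) ∞ (Function.uncurry F) (Set.univ ×ˢ U))
    {k : M → ℂ} (hk : Continuous k) {u : E} (hu : u ∈ U) :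
    HasFDerivAt (fun w => ∫ y, k y * F y w ∂μ) (∫ y, k y • fderiv ℝ (F y) u ∂μ) u := by
  have hcont : ∀ w ∈ U, Continuous fun y => F y w := fun w hw =>
    hF.continuousOn.comp_continuous (f := fun y => (y, w)) (by fun_prop) fun y => ⟨trivial, hw⟩
  have hdc := (contMDiffOn_fderiv_param hU hF).continuousOn
  have hdcont : ∀ w ∈ U, Continuous fun y => fderiv ℝ (F y) w := fun w hw =>
    hdc.comp_continuous (f := fun y => (y, w)) (by fun_prop) fun y => ⟨trivial, hw⟩
  obtain ⟨ε, hε, hball⟩ := Metric.nhds_basis_closedBall.mem_iff.1 (hU.mem_nhds hu)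
  obtain ⟨C, hC⟩ := (isCompact_univ.prod (isCompact_closedBall u ε)).exists_bound_of_continuousOn
    (f := fun p : M × E => k p.1 • fderiv ℝ (F p.1) p.2)
    ((hk.comp continuous_fst).continuousOn.smul
      (hdc.mono (Set.prod_mono le_rfl hball)))
  refine hasFDerivAt_integral_of_dominated_of_fderiv_le (bound := fun _ => C)
    (F' := fun w y => k y • fderiv ℝ (F y) w) (Metric.closedBall_mem_nhds u hε) ?_ ?_ ?_ ?_
    (integrable_const _) ?_
  · filter_upwards [hU.mem_nhds hu] with w hw
    exact (hk.mul (hcont w hw)).aestronglyMeasurable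
  · exact integrable_of_continuous (hk.mul (hcont u hu))
  · exact (hk.smul (hdcont u hu)).aestronglyMeasurable
  · exact ae_of_all _ fun y w hw => hC (y, w) ⟨trivial, hw⟩
  · refine ae_of_all _ fun y w hw => ?_
    have h1 : ContMDiffAt 𝓘(ℝ, E) 𝓘(ℝ, ℂ) ∞ (F y) w :=
      ContMDiffAt.comp (I' := J.prod 𝓘(ℝ, E)) (g := Function.uncurry F) (f := fun w => (y, w)) w
        (hF.contMDiffAt ((isOpen_univ.prod hU).mem_nhds ⟨trivial, hball hw⟩))
        (contMDiffAt_const.prodMk contMDiffAt_id)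
    exact ((h1.contDiffAt.differentiableAt (by simp)).hasFDerivAt).const_mul (k y)

theorem contDiffOn_integral_param {U : Set E} (hU : IsOpen U) {k : M → ℂ} (hk : Continuous k)
    (n : ℕ) : ∀ F : M → E → ℂ,
    ContMDiffOn (J.prod 𝓘(ℝ, E)) 𝓘(ℝ, ℂ) ∞ (Function.uncurry F) (Set.univ ×ˢ U) →
    ContDiffOn ℝ n (fun w => ∫ y, k y * F y w ∂μ) U := by
  induction n with
  | zero =>
    intro F hF
    refine contDiffOn_zero.2 fun u hu => ?_
    exact (hasFDerivAt_integral_param μ hU hF hk hu).continuousAt.continuousWithinAt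
  | succ n ih =>
    intro F hF
    rw [Nat.cast_succ, contDiffOn_succ_iff_fderiv_of_isOpen hU]
    refine ⟨fun u hu => (hasFDerivAt_integral_param μ hU hF hk
      hu).differentiableAt.differentiableWithinAt, fun h => by simp at h, ?_⟩
    have hd := contMDiffOn_fderiv_param hU hF
    refine contDiffOn_clm_apply.2 fun v => ?_
    refine (ih (fun y w => fderiv ℝ (F y) w v) ?_).congr fun u hu => ?_
    · exact fun p hp => (hd p hp).clm_apply contMDiffWithinAt_const
    · rw [(hasFDerivAt_integral_param μ hU hF hk hu).fderiv, ContinuousLinearMap.integral_apply]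
      · rfl
      · refine integrable_of_continuous (hk.smul ?_)
        exact hd.continuousOn.comp_continuous (f := fun y => (y, u)) (by fun_prop)
          fun y => ⟨trivial, hu⟩

end Parametric

section Manifold

variable {E : Type*} [NormedAddCommGroup E] [NormedSpace ℝ E]
  {H : Type*} [TopologicalSpace H] {I : ModelWithCorners ℝ E H} [I.Boundaryless]
  {N : Type*} [TopologicalSpace N] [ChartedSpace H N]

theorem mfderiv_eq_fderiv_comp_extChartAt_symm {h : N → ℂ} {x : N}
    (hh : MDifferentiableAt I 𝓘(ℝ, ℂ) h x) :
    mfderiv I 𝓘(ℝ, ℂ) h x = fderiv ℝ (h ∘ (extChartAt I x).symm) (extChartAt I x x) := by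
  rw [hh.mfderiv, I.range_eq_univ, fderivWithin_univ]
  rfl

variable (I) in
/-- The derivative of a complex function in the direction of a tangent vector. -/
noncomputable def dirDeriv (h : N → ℂ) (x : N) (v : TangentSpace I x) : ℂ :=
  mfderiv I 𝓘(ℝ, ℂ) h x v

theorem dirDeriv_eq {h : N → ℂ} {x : N} (hh : MDifferentiableAt I 𝓘(ℝ, ℂ) h x)
    (v : TangentSpace I x) : dirDeriv I h x v
      = fderiv ℝ (h ∘ (extChartAt I x).symm) (extChartAt I x x) (v : E) := by
  rw [dirDeriv, mfderiv_eq_fderiv_comp_extChartAt_symm hh]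
  rfl

variable [IsManifold I ∞ N] [FiniteDimensional ℝ E]
  {E' : Type*} [NormedAddCommGroup E'] [NormedSpace ℝ E']
  {H' : Type*} [TopologicalSpace H'] {J : ModelWithCorners ℝ E' H'}
  {M : Type*} [TopologicalSpace M] [ChartedSpace H' M] [IsManifold J ∞ M]

theorem contMDiffOn_comp_extChartAt_symm {F : M → N → ℂ}
    (hF : ContMDiff (J.prod I) 𝓘(ℝ, ℂ) ∞ (Function.uncurry F)) (x : N) :
    ContMDiffOn (J.prod 𝓘(ℝ, E)) 𝓘(ℝ, ℂ) ∞
      (Function.uncurry fun y u => F y ((extChartAt I x).symm u))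
      (Set.univ ×ˢ (extChartAt I x).target) := by
  refine hF.comp_contMDiffOn (f := fun p : M × E => (p.1, (extChartAt I x).symm p.2)) ?_
  refine contMDiffOn_fst.prodMk ?_
  exact (contMDiffOn_extChartAt_symm x).comp contMDiffOn_snd fun p hp => hp.2

theorem contMDiff_dirDeriv_param {F : M → N → ℂ}
    (hF : ContMDiff (J.prod I) 𝓘(ℝ, ℂ) ∞ (Function.uncurry F)) (x : N) (v : TangentSpace I x) :
    ContMDiff J 𝓘(ℝ, ℂ) ∞ fun y => dirDeriv I (F y) x v := by
  have hFy : ∀ y, ContMDiff I 𝓘(ℝ, ℂ) ∞ (F y) := fun y =>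
    hF.comp (f := fun z => (y, z)) (contMDiff_const.prodMk contMDiff_id)
  have h1 := contMDiffOn_fderiv_param (isOpen_extChartAt_target x)
    (contMDiffOn_comp_extChartAt_symm hF x)
  have h2 : ContMDiff J 𝓘(ℝ, E →L[ℝ] ℂ) ∞ fun y =>
      fderiv ℝ (F y ∘ (extChartAt I x).symm) (extChartAt I x x) :=
    h1.comp_contMDiff (f := fun y => (y, extChartAt I x x))
      (contMDiff_id.prodMk contMDiff_const) fun y => ⟨trivial, mem_extChartAt_target x⟩
  have h3 : ContMDiff J 𝓘(ℝ, ℂ) ∞ fun y =>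
      fderiv ℝ (F y ∘ (extChartAt I x).symm) (extChartAt I x x) (v : E) :=
    h2.clm_apply contMDiff_const
  refine h3.congr fun y => ?_
  rw [dirDeriv_eq ((hFy y).mdifferentiableAt (by simp))]

variable [CompactSpace M] [MeasurableSpace M] [BorelSpace M] [SecondCountableTopology M]
  (μ : Measure M) [IsFiniteMeasure μ]

theorem contMDiff_integral_param {F : M → N → ℂ}
    (hF : ContMDiff (J.prod I) 𝓘(ℝ, ℂ) ∞ (Function.uncurry F)) {k : M → ℂ} (hk : Continuous k) :
    ContMDiff I 𝓘(ℝ, ℂ) ∞ fun x => ∫ y, k y * F y x ∂μ := by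
  intro x
  have h1 : ContDiffOn ℝ ∞ (fun u => ∫ y, k y * F y ((extChartAt I x).symm u) ∂μ)
      (extChartAt I x).target :=
    contDiffOn_infty.2 fun n => contDiffOn_integral_param μ (isOpen_extChartAt_target x) hk n _
      (contMDiffOn_comp_extChartAt_symm hF x)
  have h2 : ContMDiffAt I 𝓘(ℝ, ℂ) ∞
      ((fun u => ∫ y, k y * F y ((extChartAt I x).symm u) ∂μ) ∘ extChartAt I x) x :=
    ((h1.contDiffAt ((isOpen_extChartAt_target x).mem_nhds
      (mem_extChartAt_target x))).contMDiffAt).comp x contMDiffAt_extChartAt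
  refine h2.congr_of_eventuallyEq ?_
  filter_upwards [extChartAt_source_mem_nhds (I := I) x] with z hz
  simp only [Function.comp_apply, (extChartAt I x).left_inv hz]

theorem dirDeriv_integral_param {F : M → N → ℂ}
    (hF : ContMDiff (J.prod I) 𝓘(ℝ, ℂ) ∞ (Function.uncurry F)) {k : M → ℂ} (hk : Continuous k)
    (x : N) (v : TangentSpace I x) :
    dirDeriv I (fun x => ∫ y, k y * F y x ∂μ) x v = ∫ y, k y * dirDeriv I (F y) x v ∂μ := by
  have hFy : ∀ y, ContMDiff I 𝓘(ℝ, ℂ) ∞ (F y) := fun y =>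
    hF.comp (f := fun z => (y, z)) (contMDiff_const.prodMk contMDiff_id)
  have hF' := contMDiffOn_comp_extChartAt_symm hF x
  have hopen := isOpen_extChartAt_target (I := I) x
  have hx := mem_extChartAt_target (I := I) x
  have hd := contMDiffOn_fderiv_param hopen hF'
  rw [dirDeriv_eq
    ((contMDiff_integral_param μ hF hk).mdifferentiableAt (by simp))]
  have h1 := (hasFDerivAt_integral_param μ hopen hF' hk hx).fderiv
  have h2 : (fderiv ℝ ((fun x => ∫ y, k y * F y x ∂μ) ∘ (extChartAt I x).symm)
      (extChartAt I x x)) (v : E) = (∫ y, k y • fderiv ℝ (fun u => F y ((extChartAt I x).symm u))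
        (extChartAt I x x) ∂μ) (v : E) := by
    rw [← h1]; rfl
  have h3 : ∀ w : E, (∫ y, k y • fderiv ℝ (fun u => F y ((extChartAt I x).symm u))
      (extChartAt I x x) ∂μ) w = ∫ y, k y * fderiv ℝ (fun u => F y ((extChartAt I x).symm u))
      (extChartAt I x x) w ∂μ := by
    intro w
    rw [ContinuousLinearMap.integral_apply]
    · rfl
    · refine integrable_of_continuous (hk.smul ?_)
      exact hd.continuousOn.comp_continuous (f := fun y => (y, extChartAt I x x)) (by fun_prop)
        fun y => ⟨trivial, hx⟩
  refine h2.trans ((h3 v).trans (integral_congr_ae (ae_of_all _ fun y => ?_)))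
  simp only
  rw [dirDeriv_eq ((hFy y).mdifferentiableAt (by simp))]
  rfl

end Manifold

/-! ### Approximation of smooth functions by matrix coefficients -/

section Average

variable {G : Type*} [Group G] [TopologicalSpace G] [IsTopologicalGroup G] [CompactSpace G]
  [MeasurableSpace G] [BorelSpace G] [SecondCountableTopology G]
  (μ : Measure G) [IsProbabilityMeasure μ]

/-- The average `x ↦ ∫ k(y) f(y x) dy` of left translates. -/
noncomputable def leftAverage (k f : G → ℂ) (x : G) : ℂ := ∫ y, k y * f (y * x) ∂μ

/-- Averages against an approximate identity converge uniformly. -/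
theorem tendstoUniformly_leftAverage {φ : ℕ → G → ℝ} (hφc : ∀ n, Continuous (φ n))
    (hφ0 : ∀ n x, 0 ≤ φ n x) (hφ1 : ∀ n, ∫ x, φ n x ∂μ = 1)
    (hφs : ∀ U ∈ 𝓝 (1 : G), ∀ᶠ n in atTop, Function.support (φ n) ⊆ U)
    {k : ℕ → G → ℂ} (hk : ∀ n, Continuous (k n))
    (hkφ : Tendsto (fun n => ∫ x, ‖k n x - φ n x‖ ∂μ) atTop (𝓝 0))
    {g : G → ℂ} (hg : Continuous g) :
    TendstoUniformly (fun n => leftAverage μ (k n) g) g atTop := by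
  rw [Metric.tendstoUniformly_iff]
  intro ε hε
  obtain ⟨C, hC⟩ := isCompact_univ.exists_bound_of_continuousOn hg.continuousOn
  have hC0 : 0 ≤ C := (norm_nonneg _).trans (hC 1 trivial)
  let T : C(G, C(G, ℂ)) := ContinuousMap.curry ⟨fun p => g (p.1 * p.2), by fun_prop⟩
  have hU : {y | dist (T y) (T 1) < ε / 2} ∈ 𝓝 (1 : G) :=
    T.continuous.continuousAt (Metric.ball_mem_nhds _ (by positivity))
  have h1 : ∀ᶠ n in atTop, ∫ x, ‖k n x - φ n x‖ ∂μ < ε / 2 / (C + 1) :=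
    hkφ.eventually_lt_const (by positivity)
  filter_upwards [h1, hφs _ hU] with n hn hs x
  have hint : ∀ {q : G → ℂ}, Continuous q → Integrable (fun y => q y * g (y * x)) μ := fun hq =>
    integrable_of_continuous (hq.mul (by fun_prop))
  have hφc' : Continuous fun y => (φ n y : ℂ) := Complex.continuous_ofReal.comp (hφc n)
  have hgx : g x = ∫ y, (φ n y : ℂ) * g x ∂μ := by
    rw [integral_mul_const, integral_complex_ofReal, hφ1, Complex.ofReal_one, one_mul]
  have hgi : Integrable (fun y => (φ n y : ℂ) * g x) μ :=
    integrable_of_continuous (hφc'.mul continuous_const)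
  have e1 : leftAverage μ (k n) g x - g x
      = ∫ y, (k n y - φ n y) * g (y * x) ∂μ + ∫ y, (φ n y : ℂ) * (g (y * x) - g x) ∂μ := by
    conv_lhs => rw [hgx]
    simp_rw [sub_mul, mul_sub]
    rw [integral_sub (hint (hk n)) (hint hφc'), integral_sub (hint hφc') hgi, leftAverage]
    ring
  have b1 : ‖∫ y, (k n y - φ n y) * g (y * x) ∂μ‖ ≤ (∫ y, ‖k n y - φ n y‖ ∂μ) * C := by
    rw [← integral_mul_const]
    refine norm_integral_le_of_norm_le
      (integrable_of_continuous ((((hk n).sub hφc').norm).mul continuous_const))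
      (ae_of_all _ fun y => ?_)
    rw [norm_mul]
    exact mul_le_mul_of_nonneg_left (hC _ trivial) (norm_nonneg _)
  have b2 : ‖∫ y, (φ n y : ℂ) * (g (y * x) - g x) ∂μ‖ ≤ ε / 2 := by
    have : ∫ y, φ n y * (ε / 2) ∂μ = ε / 2 := by rw [integral_mul_const, hφ1, one_mul]
    rw [← this]
    refine norm_integral_le_of_norm_le (integrable_of_continuous ((hφc n).mul continuous_const))
      (ae_of_all _ fun y => ?_)
    rw [norm_mul, Complex.norm_real, Real.norm_of_nonneg (hφ0 n y)]
    by_cases hy : φ n y = 0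
    · simp [hy]
    · refine mul_le_mul_of_nonneg_left ?_ (hφ0 n y)
      have h2 : dist (T y) (T 1) < ε / 2 := hs hy
      have h3 := (ContinuousMap.dist_apply_le_dist (f := T y) (g := T 1) x).trans h2.le
      simpa [T, dist_eq_norm] using h3
  rw [dist_comm, dist_eq_norm, e1]
  have hlt : (∫ y, ‖k n y - φ n y‖ ∂μ) * C < ε / 2 := by
    have h0 : 0 ≤ ∫ y, ‖k n y - φ n y‖ ∂μ := integral_nonneg fun _ => norm_nonneg _
    calc _ ≤ (∫ y, ‖k n y - φ n y‖ ∂μ) * (C + 1) := by gcongr; linarith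
      _ < ε / 2 / (C + 1) * (C + 1) := by gcongr
      _ = ε / 2 := by field_simp
  calc _ ≤ _ := norm_add_le _ _
    _ < ε / 2 + ε / 2 := by linarith
    _ = ε := by ring

variable [μ.IsHaarMeasure]

theorem leftAverage_mat_inv (ξ : IrrepMatrix G) (i j : Fin ξ.dim) {f : G → ℂ} (hf : Continuous f)
    (x : G) : leftAverage μ (fun y => ξ.mat y⁻¹ i j) f x
      = ∑ a, ξ.mat x i a * ∫ z, ξ.mat z⁻¹ a j * f z ∂μ := by
  have := isMulRightInvariant_of_compactSpace μ
  rw [leftAverage, ← integral_mul_right_eq_self _ x⁻¹]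
  simp only [inv_mul_cancel_right, mul_inv_rev, inv_inv, ξ.mat_mul, Matrix.mul_apply,
    Finset.sum_mul]
  rw [integral_finsetSum]
  · refine Finset.sum_congr rfl fun a _ => ?_
    rw [← integral_const_mul]
    exact integral_congr_ae (ae_of_all _ fun z => by simp only; ring)
  · intro a _
    exact integrable_of_continuous ((continuous_const.mul
      ((ξ.continuous_mat_apply a j).comp continuous_inv)).mul hf)

theorem leftAverage_star_mem_coeffSpan {p : C(G, ℂ)} (hp : p ∈ coeffSpan G) {f : G → ℂ}
    (hf : Continuous f) :
    ∃ h ∈ coeffSpan G, ∀ x, h x = leftAverage μ (fun y => star (p y)) f x := by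
  have hint : ∀ (q : C(G, ℂ)) (x : G), Integrable (fun y => star (q y) * f (y * x)) μ :=
    fun q x => integrable_of_continuous (by fun_prop)
  induction hp using Submodule.span_induction with
  | mem q hq =>
    obtain ⟨ξ, i, j, rfl⟩ := hq
    refine ⟨∑ a, (∫ z, ξ.mat z⁻¹ a i * f z ∂μ) • ξ.coeff j a, Submodule.sum_mem _ fun a _ =>
      Submodule.smul_mem _ _ (Submodule.subset_span ⟨ξ, j, a, rfl⟩), fun x => ?_⟩
    have h1 : (fun y => star (ξ.coeff i j y)) = fun y => ξ.mat y⁻¹ j i := by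
      funext y
      rw [ξ.mat_inv]
      rfl
    rw [h1, leftAverage_mat_inv μ ξ j i hf, ContinuousMap.sum_apply]
    exact Finset.sum_congr rfl fun a _ => mul_comm _ _
  | zero => exact ⟨0, Submodule.zero_mem _, fun x => by simp [leftAverage]⟩
  | add q q' _ _ h1 h2 =>
    obtain ⟨u, hu, hu'⟩ := h1
    obtain ⟨v, hv, hv'⟩ := h2
    refine ⟨u + v, Submodule.add_mem _ hu hv, fun x => ?_⟩
    simp only [ContinuousMap.add_apply, hu', hv', leftAverage, star_add, add_mul]
    rw [integral_add (hint q x) (hint q' x)]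
  | smul c q _ h1 =>
    obtain ⟨u, hu, hu'⟩ := h1
    refine ⟨star c • u, Submodule.smul_mem _ _ hu, fun x => ?_⟩
    simp only [ContinuousMap.smul_apply, smul_eq_mul, hu', leftAverage, star_mul', mul_assoc]
    rw [integral_const_mul]

end Average

section Lie

variable {E : Type*} [NormedAddCommGroup E] [NormedSpace ℝ E] [FiniteDimensional ℝ E]
  {H : Type*} [TopologicalSpace H] {I : ModelWithCorners ℝ E H} [I.Boundaryless]
  {G : Type*} [Group G] [TopologicalSpace G] [ChartedSpace H G] [LieGroup I ∞ G]

theorem lieDeriv_eq_dirDeriv {f : G → ℂ} (hf : ContMDiff I 𝓘(ℝ, ℂ) ∞ f) (v : GroupLieAlgebra I G)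
    (x : G) : lieDeriv v f x = dirDeriv I (fun z => f (x * z)) 1 v := by
  have h1 := mfderiv_comp (I' := I) (1 : G) (g := f) (f := fun z => x * z)
    (hf.mdifferentiableAt (by simp))
    ((contMDiff_mul_left (I := I) (n := ∞) (a := x)).mdifferentiableAt (by simp))
  have h2 : ∀ z, z = x → ∀ w : E, dirDeriv I f x w = dirDeriv I f z w := by
    rintro z rfl w; rfl
  have h3 : dirDeriv I (fun z => f (x * z)) 1 v
      = dirDeriv I f (x * 1) (mfderiv I I (fun z => x * z) 1 v) := by
    unfold dirDeriv
    exact congrArg (fun D => D v) h1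
  rw [h3]
  exact h2 _ (mul_one x) _

theorem contMDiff_lieDeriv {f : G → ℂ} (hf : ContMDiff I 𝓘(ℝ, ℂ) ∞ f)
    (v : GroupLieAlgebra I G) : ContMDiff I 𝓘(ℝ, ℂ) ∞ (lieDeriv v f) := by
  have : IsManifold I ∞ G := ContMDiffMul.toIsManifold (n := ∞)
  have h : ContMDiff (I.prod I) 𝓘(ℝ, ℂ) ∞ (Function.uncurry fun x z : G => f (x * z)) :=
    hf.comp (contMDiff_mul I ∞)
  exact (contMDiff_dirDeriv_param h 1 v).congr fun x => lieDeriv_eq_dirDeriv hf v x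

theorem contMDiff_iteratedLieDeriv {f : G → ℂ} (hf : ContMDiff I 𝓘(ℝ, ℂ) ∞ f)
    (l : List (GroupLieAlgebra I G)) : ContMDiff I 𝓘(ℝ, ℂ) ∞ (iteratedLieDeriv l f) := by
  induction l with
  | nil => exact hf
  | cons v l ih => exact contMDiff_lieDeriv ih v

theorem lieDeriv_comp_mul_left {f : G → ℂ} (hf : ContMDiff I 𝓘(ℝ, ℂ) ∞ f)
    (v : GroupLieAlgebra I G) (y x : G) :
    lieDeriv v (fun z => f (y * z)) x = lieDeriv v f (y * x) := by
  have h : ContMDiff I 𝓘(ℝ, ℂ) ∞ fun z => f (y * z) := hf.comp contMDiff_mul_left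
  rw [lieDeriv_eq_dirDeriv hf, lieDeriv_eq_dirDeriv h]
  simp only [mul_assoc]

variable [IsTopologicalGroup G] [CompactSpace G] [T2Space G]
  [MeasurableSpace G] [BorelSpace G] [SecondCountableTopology G]
  (μ : Measure G) [IsProbabilityMeasure μ]

theorem contMDiff_leftAverage {k f : G → ℂ} (hk : Continuous k)
    (hf : ContMDiff I 𝓘(ℝ, ℂ) ∞ f) : ContMDiff I 𝓘(ℝ, ℂ) ∞ (leftAverage μ k f) := by
  have : IsManifold I ∞ G := ContMDiffMul.toIsManifold (n := ∞)
  exact contMDiff_integral_param (J := I) μ (F := fun y x => f (y * x))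
    (hf.comp (contMDiff_mul I ∞)) hk

theorem lieDeriv_leftAverage {k f : G → ℂ} (hk : Continuous k)
    (hf : ContMDiff I 𝓘(ℝ, ℂ) ∞ f) (v : GroupLieAlgebra I G) :
    lieDeriv v (leftAverage μ k f) = leftAverage μ k (lieDeriv v f) := by
  have : IsManifold I ∞ G := ContMDiffMul.toIsManifold (n := ∞)
  funext x
  refine (dirDeriv_integral_param (J := I) μ (F := fun y x => f (y * x))
    (hf.comp (contMDiff_mul I ∞)) hk x (mulInvariantVectorField v x)).trans ?_
  refine integral_congr_ae (ae_of_all _ fun y => ?_)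
  exact congrArg (k y * ·) (lieDeriv_comp_mul_left hf v y x)

theorem iteratedLieDeriv_leftAverage {k f : G → ℂ} (hk : Continuous k)
    (hf : ContMDiff I 𝓘(ℝ, ℂ) ∞ f) (l : List (GroupLieAlgebra I G)) :
    iteratedLieDeriv l (leftAverage μ k f) = leftAverage μ k (iteratedLieDeriv l f) := by
  induction l with
  | nil => rfl
  | cons v l ih =>
    change lieDeriv v (iteratedLieDeriv l _) = leftAverage μ k (lieDeriv v (iteratedLieDeriv l f))
    rw [ih, lieDeriv_leftAverage μ hk (contMDiff_iteratedLieDeriv hf l)]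

variable [μ.IsHaarMeasure]

variable (I) in
theorem exists_smooth_approximate_identity : ∃ φ : ℕ → G → ℝ,
    (∀ n, ContMDiff I 𝓘(ℝ, ℝ) ∞ (φ n)) ∧ (∀ n x, 0 ≤ φ n x) ∧ (∀ n, ∫ x, φ n x ∂μ = 1) ∧
      ∀ U ∈ 𝓝 (1 : G), ∀ᶠ n in atTop, Function.support (φ n) ⊆ U := by
  have : IsManifold I ∞ G := ContMDiffMul.toIsManifold (n := ∞)
  obtain ⟨U, hU⟩ := (𝓝 (1 : G)).exists_antitone_basis
  have hb : ∀ n, ∃ b : SmoothBumpFunction I (1 : G), tsupport b ⊆ U n := fun n => by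
    obtain ⟨b, -, hb⟩ := (SmoothBumpFunction.nhds_basis_tsupport (I := I) (1 : G)).mem_iff.1
      (hU.1.mem_of_mem (i := n) trivial)
    exact ⟨b, hb⟩
  choose b hb using hb
  have hpos : ∀ n, 0 < ∫ x, b n x ∂μ := fun n =>
    (b n).continuous.integral_pos_of_hasCompactSupport_nonneg_nonzero
      (HasCompactSupport.of_compactSpace _) (fun _ => (b n).nonneg) (x := 1)
      (by rw [(b n).eq_one]; exact one_ne_zero)
  refine ⟨fun n x => (∫ x, b n x ∂μ)⁻¹ * b n x, fun n => contMDiff_const.mul (b n).contMDiff,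
    fun n x => mul_nonneg (inv_nonneg.2 (hpos n).le) (b n).nonneg, fun n => ?_, fun V hV => ?_⟩
  · rw [integral_const_mul, inv_mul_cancel₀ (hpos n).ne']
  · obtain ⟨m, -, hm⟩ := hU.1.mem_iff.1 hV
    filter_upwards [eventually_ge_atTop m] with n hn x hx
    refine hm (hU.2 hn (hb n (subset_tsupport _ ?_)))
    exact right_ne_zero_of_mul hx

variable (I) in
/-- Matrix coefficients of continuous representations are smooth. -/
theorem IrrepMatrix.contMDiff_mat_apply (μ : Measure G) [IsProbabilityMeasure μ] [μ.IsHaarMeasure]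
    (ξ : IrrepMatrix G) (i j : Fin ξ.dim) :
    ContMDiff I 𝓘(ℝ, ℂ) ∞ fun x => ξ.mat x i j := by
  obtain ⟨φ, hφ, hφ0, hφ1, hφs⟩ := exists_smooth_approximate_identity I μ
  have hφC : ∀ n, ContMDiff I 𝓘(ℝ, ℂ) ∞ fun x => (φ n x : ℂ) := fun n =>
    Complex.ofRealCLM.contDiff.contMDiff.comp (hφ n)
  let B : ℕ → Matrix (Fin ξ.dim) (Fin ξ.dim) ℂ := fun n =>
    Matrix.of fun a b => ∫ z, ξ.mat z⁻¹ a b * (φ n z : ℂ) ∂μ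
  have hB : Tendsto B atTop (𝓝 1) := by
    refine tendsto_pi_nhds.2 fun a => tendsto_pi_nhds.2 fun b => ?_
    have h1 := (tendstoUniformly_leftAverage μ (fun n => (hφ n).continuous) hφ0 hφ1 hφs
      (k := fun n x => (φ n x : ℂ)) (fun n => (hφC n).continuous) (by simp)
      (g := fun z => ξ.mat z⁻¹ a b)
      ((ξ.continuous_mat_apply a b).comp continuous_inv)).tendsto_at 1
    rw [inv_one, ξ.mat_one] at h1
    refine h1.congr fun n => ?_
    simp only [leftAverage, mul_one, B, Matrix.of_apply]
    exact integral_congr_ae (ae_of_all _ fun z => mul_comm _ _)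
  have hdet : Tendsto (fun n => (B n).det) atTop (𝓝 1) := by
    have := (Continuous.matrix_det continuous_id).continuousAt.tendsto.comp hB
    rw [id, Matrix.det_one] at this
    exact this
  obtain ⟨n, hn⟩ := (hdet.eventually_ne one_ne_zero).exists
  have hinv : B n * (B n)⁻¹ = 1 := Matrix.mul_nonsing_inv _ (isUnit_iff_ne_zero.2 hn)
  have hsm : ∀ a, ContMDiff I 𝓘(ℝ, ℂ) ∞
      (leftAverage μ (fun y => ξ.mat y⁻¹ i a) fun x => (φ n x : ℂ)) := fun a =>
    contMDiff_leftAverage μ ((ξ.continuous_mat_apply i a).comp continuous_inv) (hφC n)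
  have hfin : ContMDiff I 𝓘(ℝ, ℂ) ∞ fun x => ∑ a,
      leftAverage μ (fun y => ξ.mat y⁻¹ i a) (fun x => (φ n x : ℂ)) x * (B n)⁻¹ a j :=
    contMDiff_finsetSum fun a _ =>
      (((ContinuousLinearMap.mul ℝ ℂ).flip ((B n)⁻¹ a j)).contDiff.contMDiff).comp (hsm a)
  refine hfin.congr fun x => ?_
  have h1 : ξ.mat x = ξ.mat x * B n * (B n)⁻¹ := by rw [Matrix.mul_assoc, hinv, Matrix.mul_one]
  conv_lhs => rw [h1, Matrix.mul_apply]
  refine Finset.sum_congr rfl fun a _ => ?_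
  rw [leftAverage_mat_inv μ ξ i a (hφC n).continuous, Matrix.mul_apply]
  rfl

/-- Closed subspaces of `C^∞(G)` containing all matrix coefficients are everything. -/
theorem eq_top_of_coeff_mem (μ : Measure G) [IsProbabilityMeasure μ] [μ.IsHaarMeasure]
    {ξ : UnitaryDual G → IrrepMatrix G} (hξ : IsChoiceOfRepresentatives ξ)
    (S : Submodule ℂ (SmoothFun I G)) (hS : IsClosed (S : Set (SmoothFun I G)))
    (hmem : ∀ c i j (u : SmoothFun I G), (∀ x, u x = (ξ c).mat x i j) → u ∈ S) : S = ⊤ := by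
  have hspan : ∀ h ∈ coeffSpan G, ∃ u ∈ S, ∀ x, u x = h x := by
    intro h hh
    rw [hξ.coeffSpan_eq] at hh
    induction hh using Submodule.span_induction with
    | mem q hq =>
      obtain ⟨c, i, j, rfl⟩ := hq
      let u : SmoothFun I G := ⟨fun x => (ξ c).mat x i j, (ξ c).contMDiff_mat_apply I μ i j⟩
      exact ⟨u, hmem c i j u fun _ => rfl, fun _ => rfl⟩
    | zero => exact ⟨0, S.zero_mem, fun _ => rfl⟩
    | add q q' _ _ h1 h2 =>
      obtain ⟨u, hu, hu'⟩ := h1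
      obtain ⟨v, hv, hv'⟩ := h2
      exact ⟨u + v, S.add_mem hu hv, fun x => congrArg₂ (· + ·) (hu' x) (hv' x)⟩
    | smul a q _ h1 =>
      obtain ⟨u, hu, hu'⟩ := h1
      exact ⟨a • u, S.smul_mem a hu, fun x => congrArg (a * ·) (hu' x)⟩
  rw [eq_top_iff]
  intro f _
  have hf : ContMDiff I 𝓘(ℝ, ℂ) ∞ (f : G → ℂ) := f.2
  obtain ⟨φ, hφ, hφ0, hφ1, hφs⟩ := exists_smooth_approximate_identity I μ
  have hp : ∀ n : ℕ, ∃ p ∈ coeffSpan G, ∫ x, ‖p x - (φ n x : ℂ)‖ ∂μ < 1 / ((n : ℝ) + 1) := fun n =>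
    exists_mem_coeffSpan_integral_norm_sub_lt μ
      ⟨fun x => (φ n x : ℂ), Complex.continuous_ofReal.comp (hφ n).continuous⟩ (by positivity)
  choose p hp1 hp2 using hp
  have hkc : ∀ n, Continuous fun y => star (p n y) := fun n => (p n).continuous.star
  have hk : Tendsto (fun n => ∫ x, ‖star (p n x) - (φ n x : ℂ)‖ ∂μ) atTop (𝓝 0) := by
    refine squeeze_zero (fun n => integral_nonneg fun _ => norm_nonneg _) (fun n => ?_)
      tendsto_one_div_add_atTop_nhds_zero_nat
    refine le_trans (le_of_eq (integral_congr_ae (ae_of_all _ fun x => ?_))) (hp2 n).le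
    simp only
    rw [← norm_star (p n x - (φ n x : ℂ)), star_sub]
    simp
  have hu : ∀ n, ∃ u ∈ S, ∀ x, u x = leftAverage μ (fun y => star (p n y)) f x := by
    intro n
    obtain ⟨h, hh, hh'⟩ := leftAverage_star_mem_coeffSpan μ (hp1 n) hf.continuous
    obtain ⟨u, hu, hu'⟩ := hspan h hh
    exact ⟨u, hu, fun x => (hu' x).trans (hh' x)⟩
  choose u huS hu using hu
  refine hS.mem_of_tendsto (b := atTop) (f := u) ?_ (Eventually.of_forall huS)
  rw [nhds_induced, tendsto_comap_iff, tendsto_pi_nhds]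
  intro l
  rw [UniformFun.tendsto_iff_tendstoUniformly]
  have h1 := tendstoUniformly_leftAverage μ (fun n => (hφ n).continuous) hφ0 hφ1 hφs hkc hk
    (contMDiff_iteratedLieDeriv hf l).continuous
  have h2 : ∀ n, (u n : G → ℂ) = leftAverage μ (fun y => star (p n y)) f := fun n => funext (hu n)
  have h3 : (fun n => iteratedLieDeriv l (u n : G → ℂ))
      = fun n => leftAverage μ (fun y => star (p n y)) (iteratedLieDeriv l (f : G → ℂ)) :=
    funext fun n => by rw [h2, iteratedLieDeriv_leftAverage μ (hkc n) hf]
  rw [← h3] at h1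
  exact h1

end Lie

/-! ### Sums of rank one operators -/

section Nuclear

variable {E F ι : Type*} [NormedAddCommGroup E] [NormedSpace ℂ E]
  [NormedAddCommGroup F] [NormedSpace ℂ F]

theorem summable_of_summable_rpow {b : ι → ℝ} (hb : ∀ i, 0 ≤ b i) {r : ℝ} (hr0 : 0 < r)
    (hr1 : r ≤ 1) (h : Summable fun i => b i ^ r) : Summable b := by
  refine Summable.of_norm_bounded_eventually h ?_
  filter_upwards [h.tendsto_cofinite_zero.eventually_lt_const one_pos] with i hi
  rw [Real.norm_of_nonneg (hb i)]
  have h1 : b i < 1 := by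
    by_contra! hge
    exact absurd hi (not_lt.2 (Real.one_le_rpow hge hr0.le))
  rcases (hb i).eq_or_lt with h0 | h0
  · rw [← h0, Real.zero_rpow hr0.ne']
  · calc b i = b i ^ (1 : ℝ) := (Real.rpow_one _).symm
      _ ≤ b i ^ r := Real.rpow_le_rpow_of_exponent_ge h0 h1.le hr1

theorem exists_isRNuclear_of_summable [CompleteSpace F] [Countable ι] (x' : ι → E →L[ℂ] ℂ)
    (y : ι → F) {r : ℝ} (hr0 : 0 < r) (hr1 : r ≤ 1)
    (h : Summable fun i => ‖x' i‖ ^ r * ‖y i‖ ^ r) :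
    ∃ T : E →L[ℂ] F, IsRNuclear r T ∧ (∀ x, HasSum (fun i => x' i x • y i) (T x)) ∧
      Summable fun i => ‖x' i‖ * ‖y i‖ := by
  have h1 : Summable fun i => ‖x' i‖ * ‖y i‖ := by
    refine summable_of_summable_rpow (fun i => by positivity) hr0 hr1 (h.congr fun i => ?_)
    rw [Real.mul_rpow (norm_nonneg _) (norm_nonneg _)]
  have h2 : Summable fun i => (x' i).smulRight (y i) :=
    Summable.of_norm (h1.congr fun i => (ContinuousLinearMap.norm_smulRight_apply _ _).symm)
  obtain ⟨T, hT⟩ := h2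
  have h3 : ∀ x, HasSum (fun i => x' i x • y i) (T x) := fun x =>
    hT.mapL (ContinuousLinearMap.apply ℂ F x)
  refine ⟨T, ?_, h3, h1⟩
  obtain ⟨e, he⟩ := exists_injective_nat ι
  refine ⟨Function.extend e x' 0, Function.extend e y 0, fun x => ?_, ?_⟩
  · have : (fun n => Function.extend e x' 0 n x • Function.extend e y 0 n)
        = Function.extend e (fun i => x' i x • y i) 0 := by
      funext n
      by_cases hn : ∃ i, e i = n
      · obtain ⟨i, rfl⟩ := hn
        simp only [he.extend_apply]
      · simp only [Function.extend_apply' _ _ _ hn, Pi.zero_apply, smul_zero]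
    rw [this, hasSum_extend_zero he]
    exact h3 x
  · have : (fun n => ‖Function.extend e x' 0 n‖ ^ r * ‖Function.extend e y 0 n‖ ^ r)
        = Function.extend e (fun i => ‖x' i‖ ^ r * ‖y i‖ ^ r) 0 := by
      funext n
      by_cases hn : ∃ i, e i = n
      · obtain ⟨i, rfl⟩ := hn
        simp only [he.extend_apply]
      · simp only [Function.extend_apply' _ _ _ hn, Pi.zero_apply, norm_zero,
          Real.zero_rpow hr0.ne', mul_zero]
    rw [this]
    exact (summable_extend_zero he).2 h

end Nuclear

section LpSum

variable {X ι : Type*} [MeasurableSpace X] {μ : Measure X} [IsProbabilityMeasure μ] [Countable ι]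
  {p : ℝ≥0∞} [Fact (1 ≤ p)]

theorem Lp.ae_hasSum {g : ι → Lp ℂ p μ} {S : Lp ℂ p μ} (hg : Summable fun i => ‖g i‖)
    (hS : HasSum g S) : ∀ᵐ x ∂μ, HasSum (fun i => g i x) (S x) := by
  have hsum : ∀ᵐ x ∂μ, Summable fun i => g i x := by
    have hmeas : ∀ i, AEMeasurable (fun x => ‖g i x‖ₑ) μ := fun i =>
      (Lp.aestronglyMeasurable (g i)).enorm
    have hfin : ∫⁻ x, ∑' i, ‖g i x‖ₑ ∂μ ≠ ⊤ := by
      rw [lintegral_tsum hmeas]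
      have h1 : ∀ i, ∫⁻ x, ‖g i x‖ₑ ∂μ ≤ (‖g i‖₊ : ℝ≥0∞) := by
        intro i
        rw [← eLpNorm_one_eq_lintegral_enorm]
        refine (eLpNorm_le_eLpNorm_of_exponent_le (Fact.out : 1 ≤ p)
          (Lp.aestronglyMeasurable (g i))).trans_eq ?_
        exact (Lp.enorm_def (g i)).symm
      refine ne_top_of_le_ne_top ?_ (ENNReal.tsum_le_tsum h1)
      exact ENNReal.tsum_coe_ne_top_iff_summable.2 (NNReal.summable_coe.1 hg)
    filter_upwards [ae_lt_top' (AEMeasurable.tsum hmeas) hfin] with x hx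
    refine Summable.of_nnnorm (ENNReal.tsum_coe_ne_top_iff_summable.1 ?_)
    exact hx.ne
  have hm : TendstoInMeasure μ (fun (s : Finset ι) => ⇑(∑ i ∈ s, g i)) atTop S :=
    tendstoInMeasure_of_tendsto_Lp hS
  obtain ⟨ns, hns, hlim⟩ := hm.exists_seq_tendsto_ae'
  have hco : ∀ᵐ x ∂μ, ∀ k : ℕ, (∑ i ∈ ns k, g i : Lp ℂ p μ) x = ∑ i ∈ ns k, g i x := by
    rw [ae_all_iff]
    intro k
    filter_upwards [Lp.coeFn_finsetSum (ns k) g] with x hx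
    rw [hx, Finset.sum_apply]
  filter_upwards [hsum, hlim, hco] with x h1 h2 h3
  have h4 := h1.hasSum.comp hns
  simp_rw [h3] at h2
  rw [tendsto_nhds_unique h2 h4]
  exact h1.hasSum

end LpSum

/-! ### Functionals given by bounded functions -/

section Functional

variable {X : Type*} [TopologicalSpace X] [CompactSpace X] [MeasurableSpace X] [BorelSpace X]
  (μ : Measure X) [IsProbabilityMeasure μ] (p : ℝ≥0∞) [Fact (1 ≤ p)]

/-- The functional `f ↦ ∫ f g` on `L^p` for continuous `g`. -/
noncomputable def integralMulCLM (g : C(X, ℂ)) : Lp ℂ p μ →L[ℂ] ℂ :=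
  have hint : ∀ f : Lp ℂ p μ, Integrable (fun x => f x * g x) μ := fun f =>
    ((Lp.memLp f).integrable Fact.out).mul_bdd (c := ‖g‖) g.continuous.aestronglyMeasurable
      (ae_of_all _ fun x => g.norm_coe_le_norm x)
  LinearMap.mkContinuous
    { toFun := fun f => ∫ x, f x * g x ∂μ
      map_add' := fun f h => by
        rw [← integral_add (hint f) (hint h)]
        refine integral_congr_ae ?_
        filter_upwards [Lp.coeFn_add f h] with x hx
        rw [hx, Pi.add_apply, add_mul]
      map_smul' := fun c f => by
        rw [RingHom.id_apply, smul_eq_mul, ← integral_const_mul]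
        refine integral_congr_ae ?_
        filter_upwards [Lp.coeFn_smul c f] with x hx
        rw [hx, Pi.smul_apply, smul_eq_mul, mul_assoc] } ‖g‖ (fun f => by
    have hf : Integrable f μ := (Lp.memLp f).integrable Fact.out
    calc ‖∫ x, f x * g x ∂μ‖ ≤ ∫ x, ‖f x‖ * ‖g‖ ∂μ := by
          refine norm_integral_le_of_norm_le (hf.norm.mul_const _) (ae_of_all _ fun x => ?_)
          rw [norm_mul]
          exact mul_le_mul_of_nonneg_left (g.norm_coe_le_norm x) (norm_nonneg _)
      _ = ‖g‖ * ∫ x, ‖f x‖ ∂μ := by rw [integral_mul_const, mul_comm]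
      _ ≤ ‖g‖ * ‖f‖ := by
          refine mul_le_mul_of_nonneg_left ?_ (norm_nonneg _)
          rw [integral_norm_eq_lintegral_enorm hf.1, ← eLpNorm_one_eq_lintegral_enorm, Lp.norm_def]
          exact ENNReal.toReal_mono (Lp.eLpNorm_ne_top f)
            (eLpNorm_le_eLpNorm_of_exponent_le Fact.out hf.1))

theorem norm_integralMulCLM_le (hp : p ≠ ⊤) (g : C(X, ℂ)) (hg : ∀ x, ‖g x‖ ≤ 1) {q : ℝ}
    (hq : q = (min 2 p).toReal) :
    ‖integralMulCLM μ p g‖ ≤ (∫ x, ‖g x‖ ^ 2 ∂μ) ^ (1 - 1 / q) := by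
  have hp1 : 1 ≤ p := Fact.out
  have hmin : min 2 p ≠ ⊤ := ne_top_of_le_ne_top hp (min_le_right _ _)
  have hqe : ENNReal.ofReal q = min 2 p := by rw [hq, ENNReal.ofReal_toReal hmin]
  have hq1 : 1 ≤ q := by
    rw [hq, ← ENNReal.toReal_one]
    exact ENNReal.toReal_mono hmin (le_min (by norm_num) hp1)
  have hq2 : q ≤ 2 := by
    rw [hq, show (2 : ℝ) = (2 : ℝ≥0∞).toReal by simp]
    exact ENNReal.toReal_mono (by simp) (min_le_left _ _)
  have hq0 : 0 < q := by linarith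
  have hθ0 : 0 ≤ 1 - 1 / q := by
    rw [sub_nonneg, div_le_one hq0]; exact hq1
  have hθ1 : 2 * (1 - 1 / q) ≤ 1 := by
    have : 1 / 2 ≤ 1 / q := one_div_le_one_div_of_le hq0 hq2
    linarith
  have hgi : Integrable (fun x => ‖g x‖ ^ 2) μ :=
    integrable_of_continuous (g.continuous.norm.pow 2)
  have hG : ∫⁻ x, ‖g x‖ₑ ^ (2 : ℝ) ∂μ = ENNReal.ofReal (∫ x, ‖g x‖ ^ 2 ∂μ) := by
    rw [ofReal_integral_eq_lintegral_ofReal hgi (ae_of_all _ fun x => by positivity)]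
    refine lintegral_congr fun x => ?_
    rw [ENNReal.ofReal_pow (norm_nonneg _), ofReal_norm, ENNReal.rpow_two]
  have hG0 : 0 ≤ ∫ x, ‖g x‖ ^ 2 ∂μ := integral_nonneg fun x => by positivity
  refine ContinuousLinearMap.opNorm_le_bound _ (Real.rpow_nonneg hG0 _) fun f => ?_
  have hfm := Lp.aestronglyMeasurable f
  have h1 : ‖∫ x, f x * g x ∂μ‖ₑ
      ≤ ‖f‖ₑ * ENNReal.ofReal ((∫ x, ‖g x‖ ^ 2 ∂μ) ^ (1 - 1 / q)) := by
    calc ‖∫ x, f x * g x ∂μ‖ₑ ≤ ∫⁻ x, ‖f x * g x‖ₑ ∂μ := enorm_integral_le_lintegral_enorm _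
      _ ≤ ∫⁻ x, (‖f x‖ₑ ^ q) ^ (1 / q) * (‖g x‖ₑ ^ (2 : ℝ)) ^ (1 - 1 / q) ∂μ := by
          refine lintegral_mono fun x => ?_
          rw [enorm_mul, ← ENNReal.rpow_mul, ← ENNReal.rpow_mul, mul_one_div_cancel hq0.ne',
            ENNReal.rpow_one]
          refine mul_le_mul_right ?_ _
          have hge : ‖g x‖ₑ ≤ 1 := by
            rw [← ofReal_norm]; exact ENNReal.ofReal_le_one.2 (hg x)
          calc ‖g x‖ₑ = ‖g x‖ₑ ^ (1 : ℝ) := (ENNReal.rpow_one _).symm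
            _ ≤ _ := ENNReal.rpow_le_rpow_of_exponent_ge hge hθ1
      _ ≤ (∫⁻ x, ‖f x‖ₑ ^ q ∂μ) ^ (1 / q) * (∫⁻ x, ‖g x‖ₑ ^ (2 : ℝ) ∂μ) ^ (1 - 1 / q) :=
          ENNReal.lintegral_mul_norm_pow_le (hfm.enorm.pow_const _)
            (g.continuous.aestronglyMeasurable.enorm.pow_const _) (by positivity) hθ0 (by ring)
      _ ≤ ‖f‖ₑ * ENNReal.ofReal ((∫ x, ‖g x‖ ^ 2 ∂μ) ^ (1 - 1 / q)) := by
          rw [hG, ENNReal.ofReal_rpow_of_nonneg hG0 hθ0]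
          refine mul_le_mul_left ?_ _
          rw [Lp.enorm_def]
          have h2 : eLpNorm f (min 2 p) μ = (∫⁻ x, ‖f x‖ₑ ^ q ∂μ) ^ (1 / q) := by
            rw [eLpNorm_eq_lintegral_rpow_enorm_toReal (by
              intro h0
              rw [h0] at hq
              simp only [ENNReal.toReal_zero] at hq
              linarith) hmin, hq]
          rw [← h2]
          exact eLpNorm_le_eLpNorm_of_exponent_le (min_le_right _ _) hfm
  have h2 := ENNReal.toReal_mono (by finiteness) h1
  rw [ENNReal.toReal_mul, toReal_enorm, toReal_enorm,
    ENNReal.toReal_ofReal (Real.rpow_nonneg hG0 _), mul_comm] at h2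
  exact h2

end Functional

/-! ### The operator associated with a symbol -/

section Symbol

variable {G : Type*} [Group G] [TopologicalSpace G] [IsTopologicalGroup G] [CompactSpace G]
  [MeasurableSpace G] [BorelSpace G] (μ : Measure G) [IsProbabilityMeasure μ]

/-- The functional `f ↦ f̂(ξ)ᵢⱼ` on `L^p`. -/
noncomputable def fourierFunctional (p : ℝ≥0∞) [Fact (1 ≤ p)] (ξ : IrrepMatrix G)
    (i j : Fin ξ.dim) : Lp ℂ p μ →L[ℂ] ℂ :=
  integralMulCLM μ p (star (ξ.coeff j i))

theorem fourierFunctional_apply (p : ℝ≥0∞) [Fact (1 ≤ p)] (ξ : IrrepMatrix G)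
    (i j : Fin ξ.dim) (f : Lp ℂ p μ) :
    fourierFunctional μ p ξ i j f = fourierCoeff μ f ξ i j := rfl

theorem norm_fourierFunctional_le [μ.IsMulLeftInvariant] (p : ℝ≥0∞) [Fact (1 ≤ p)] (hp : p ≠ ⊤)
    (ξ : IrrepMatrix G) (i j : Fin ξ.dim) :
    ‖fourierFunctional μ p ξ i j‖ ≤ ((ξ.dim : ℝ)⁻¹) ^ (1 - 1 / (min 2 p).toReal) := by
  have h := norm_integralMulCLM_le μ p hp (star (ξ.coeff j i))
    (fun x => (norm_star _).trans_le (ξ.norm_mat_apply_le x j i)) rfl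
  have h2 : ∫ x, ‖star (ξ.coeff j i) x‖ ^ 2 ∂μ = (ξ.dim : ℝ)⁻¹ := by
    have h3 := integral_mat_mul_star μ ξ j i j i
    rw [if_pos ⟨rfl, rfl⟩] at h3
    have h4 : ∀ x, ξ.mat x j i * star (ξ.mat x j i)
        = ((‖star (ξ.coeff j i) x‖ ^ 2 : ℝ) : ℂ) := by
      intro x
      rw [ContinuousMap.star_apply, norm_star, RCLike.star_def, Complex.mul_conj']
      push_cast
      rfl
    simp_rw [h4] at h3
    rw [integral_complex_ofReal] at h3
    exact Complex.ofReal_injective (by rw [h3]; push_cast; rfl)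
  rw [h2] at h
  exact h

theorem norm_mat_mul_apply_le (ξ : IrrepMatrix G) (B : Matrix (Fin ξ.dim) (Fin ξ.dim) ℂ) (x : G)
    (i j : Fin ξ.dim) : ‖(ξ.mat x * B) i j‖ ≤ (opNormLinfty Bᵀ : ℝ) := by
  calc ‖(ξ.mat x * B) i j‖ ≤ ∑ k, ‖ξ.mat x i k * B k j‖ := by
        rw [Matrix.mul_apply]; exact norm_sum_le _ _
    _ ≤ ∑ k, ‖B k j‖ := by
        refine Finset.sum_le_sum fun k _ => ?_
        rw [norm_mul]
        exact mul_le_of_le_one_left (norm_nonneg _) (ξ.norm_mat_apply_le x i k)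
    _ = ((∑ k, ‖Bᵀ j k‖₊ : ℝ≥0) : ℝ) := by push_cast; rfl
    _ ≤ (opNormLinfty Bᵀ : ℝ) := by
        exact_mod_cast Finset.le_sup (f := fun i => ∑ k, ‖Bᵀ i k‖₊) (Finset.mem_univ j)

theorem aestronglyMeasurable_mat_mul_apply (ξ : IrrepMatrix G)
    {σ : G → Matrix (Fin ξ.dim) (Fin ξ.dim) ℂ}
    (hσ : ∀ i j, AEStronglyMeasurable (fun x => σ x i j) μ) (i j : Fin ξ.dim) :
    AEStronglyMeasurable (fun x => (ξ.dim : ℂ) * (ξ.mat x * σ x) i j) μ := by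
  simp_rw [Matrix.mul_apply]
  refine aestronglyMeasurable_const.mul (Finset.aestronglyMeasurable_fun_sum _ fun k _ => ?_)
  exact (ξ.continuous_mat_apply i k).aestronglyMeasurable.mul (hσ k j)

theorem eLpNorm_mat_mul_apply_le (p : ℝ≥0∞) (ξ : IrrepMatrix G)
    (σ : G → Matrix (Fin ξ.dim) (Fin ξ.dim) ℂ) (i j : Fin ξ.dim) :
    eLpNorm (fun x => (ξ.dim : ℂ) * (ξ.mat x * σ x) i j) p μ
      ≤ ENNReal.ofReal ξ.dim * eLpNorm (fun x => (opNormLinfty (σ x)ᵀ : ℝ)) p μ := by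
  refine eLpNorm_le_mul_eLpNorm_of_ae_le_mul (ae_of_all _ fun x => ?_) p
  rw [norm_mul, Complex.norm_natCast, Real.norm_of_nonneg (NNReal.coe_nonneg _)]
  exact mul_le_mul_of_nonneg_left (norm_mat_mul_apply_le ξ _ x i j) (Nat.cast_nonneg _)

theorem symbol_exponent_identity {d N r q : ℝ} (hd : 0 < d) (hN : 0 ≤ N) :
    d * d * (((d⁻¹) ^ (1 - 1 / q)) ^ r * (d * N) ^ r) = d ^ (2 + r / q) * N ^ r := by
  have h2 : d * d = d ^ (2 : ℝ) := by rw [Real.rpow_two]; ring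
  rw [Real.mul_rpow hd.le hN, Real.inv_rpow hd.le, ← Real.rpow_neg hd.le, ← Real.rpow_mul hd.le, h2,
    ← mul_assoc, ← mul_assoc, ← Real.rpow_add hd, ← Real.rpow_add hd]
  congr 2
  ring

variable [μ.IsMulLeftInvariant]

/-- The `r`-nuclear operator with a given symbol. -/
theorem exists_isRNuclear_of_symbol [Countable (UnitaryDual G)] {r : ℝ} (hr0 : 0 < r) (hr1 : r ≤ 1)
    {p₁ p₂ : ℝ≥0∞} [Fact (1 ≤ p₁)] [Fact (1 ≤ p₂)] (hp₁ : p₁ ≠ ⊤)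
    (ξ : UnitaryDual G → IrrepMatrix G)
    (σ : ∀ c : UnitaryDual G, G → Matrix (Fin (ξ c).dim) (Fin (ξ c).dim) ℂ)
    (hσ : ∀ c i j, AEStronglyMeasurable (fun x => σ c x i j) μ)
    (hsum : ∑' c : UnitaryDual G, ((ξ c).dim : ℝ≥0∞) ^ (2 + r / (min 2 p₁).toReal) *
      (eLpNorm (fun x => (opNormLinfty (σ c x)ᵀ : ℝ)) p₂ μ) ^ r < ⊤) :
    ∃ T : Lp ℂ p₁ μ →L[ℂ] Lp ℂ p₂ μ, IsRNuclear r T ∧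
      ∀ f : Lp ℂ p₁ μ, ∀ᵐ x ∂μ, HasSum
        (fun c : UnitaryDual G =>
          ((ξ c).dim : ℂ) * ((ξ c).mat x * σ c x * fourierCoeff μ f (ξ c)).trace) (T f x) := by
  set q := (min 2 p₁).toReal
  set N : UnitaryDual G → ℝ≥0∞ := fun c => eLpNorm (fun x => (opNormLinfty (σ c x)ᵀ : ℝ)) p₂ μ
  have hd : ∀ c, (0 : ℝ) < (ξ c).dim := fun c => by exact_mod_cast (ξ c).dim_pos
  have hN : ∀ c, N c ≠ ⊤ := by
    intro c h
    have h1 := (ENNReal.le_tsum c).trans_lt hsum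
    change ((ξ c).dim : ℝ≥0∞) ^ (2 + r / q) * N c ^ r < ⊤ at h1
    rw [h, ENNReal.top_rpow_of_pos hr0, ENNReal.mul_top] at h1
    · exact lt_irrefl _ h1
    · refine (ENNReal.rpow_pos ?_ (ENNReal.natCast_ne_top _)).ne'
      exact_mod_cast (ξ c).dim_pos
  have hY : ∀ c (i j : Fin (ξ c).dim),
      MemLp (fun x => ((ξ c).dim : ℂ) * ((ξ c).mat x * σ c x) i j) p₂ μ := fun c i j =>
    ⟨aestronglyMeasurable_mat_mul_apply μ _ (hσ c) i j,
      (eLpNorm_mat_mul_apply_le μ p₂ _ _ i j).trans_lt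
        (ENNReal.mul_lt_top ENNReal.ofReal_lt_top (hN c).lt_top)⟩
  let ι := Σ c : UnitaryDual G, Fin (ξ c).dim × Fin (ξ c).dim
  let x' : ι → Lp ℂ p₁ μ →L[ℂ] ℂ := fun k => fourierFunctional μ p₁ (ξ k.1) k.2.2 k.2.1
  let y : ι → Lp ℂ p₂ μ := fun k => (hY k.1 k.2.1 k.2.2).toLp
  have hy : ∀ k : ι, ‖y k‖ ≤ (ξ k.1).dim * (N k.1).toReal := by
    intro k
    rw [Lp.norm_toLp]
    refine (ENNReal.toReal_mono (ENNReal.mul_ne_top ENNReal.ofReal_ne_top (hN k.1))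
      (eLpNorm_mat_mul_apply_le μ p₂ _ _ k.2.1 k.2.2)).trans_eq ?_
    rw [ENNReal.toReal_mul, ENNReal.toReal_ofReal (Nat.cast_nonneg _)]
  have hβ : Summable fun c => ((ξ c).dim : ℝ) ^ (2 + r / q) * (N c).toReal ^ r := by
    refine (ENNReal.summable_toReal hsum.ne).congr fun c => ?_
    rw [ENNReal.toReal_mul, ← ENNReal.toReal_rpow, ← ENNReal.toReal_rpow, ENNReal.toReal_natCast]
  have hsumm : Summable fun k : ι => ‖x' k‖ ^ r * ‖y k‖ ^ r := by
    refine (summable_sigma_of_nonneg fun k => by positivity).2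
      ⟨fun c => (hasSum_fintype _).summable, ?_⟩
    refine Summable.of_nonneg_of_le (fun c => tsum_nonneg fun _ => by positivity) (fun c => ?_) hβ
    rw [tsum_fintype, ← symbol_exponent_identity (hd c) ENNReal.toReal_nonneg]
    refine (Finset.sum_le_card_nsmul _ _
      ((((ξ c).dim : ℝ)⁻¹ ^ (1 - 1 / q)) ^ r * ((ξ c).dim * (N c).toReal) ^ r)
      fun k _ => ?_).trans_eq ?_
    · have h1 := norm_fourierFunctional_le μ p₁ hp₁ (ξ c) k.2 k.1
      have h2 := hy ⟨c, k⟩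
      gcongr
    · rw [Finset.card_univ, Fintype.card_prod, Fintype.card_fin, nsmul_eq_mul]
      push_cast
      ring
  obtain ⟨T, hT, hTsum, hTnorm⟩ := exists_isRNuclear_of_summable x' y hr0 hr1 hsumm
  refine ⟨T, hT, fun f => ?_⟩
  have hns : Summable fun k => ‖x' k f • y k‖ := by
    refine Summable.of_nonneg_of_le (fun _ => norm_nonneg _) (fun k => ?_) (hTnorm.mul_left ‖f‖)
    rw [norm_smul]
    calc ‖x' k f‖ * ‖y k‖ ≤ ‖x' k‖ * ‖f‖ * ‖y k‖ := by gcongr; exact (x' k).le_opNorm f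
      _ = ‖f‖ * (‖x' k‖ * ‖y k‖) := by ring
  have hae : ∀ᵐ x ∂μ, ∀ k : ι, (x' k f • y k : Lp ℂ p₂ μ) x
      = x' k f * (((ξ k.1).dim : ℂ) * ((ξ k.1).mat x * σ k.1 x) k.2.1 k.2.2) := by
    rw [ae_all_iff]
    intro k
    filter_upwards [Lp.coeFn_smul (x' k f) (y k), (hY k.1 k.2.1 k.2.2).coeFn_toLp] with x h1 h2
    rw [h1, Pi.smul_apply, smul_eq_mul]
    exact congrArg _ h2
  filter_upwards [Lp.ae_hasSum hns (hTsum f), hae] with x h1 h2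
  simp_rw [h2] at h1
  refine (h1.sigma fun c => hasSum_fintype _).congr_fun fun c => ?_
  rw [Matrix.trace, Finset.mul_sum, Fintype.sum_prod_type]
  refine Finset.sum_congr rfl fun i _ => ?_
  rw [Matrix.diag_apply, Matrix.mul_apply, Finset.mul_sum]
  refine Finset.sum_congr rfl fun j _ => ?_
  simp only [x', fourierFunctional_apply]
  ring

/-- The Fourier coefficients of a matrix coefficient. -/
theorem fourierCoeff_coeff_self (ξ : IrrepMatrix G) (i j a b : Fin ξ.dim) {f : G → ℂ}
    (hf : f =ᵐ[μ] fun x => ξ.mat x i j) :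
    fourierCoeff μ f ξ b a = if i = a ∧ j = b then (ξ.dim : ℂ)⁻¹ else 0 := by
  rw [← integral_mat_mul_star μ ξ i j a b]
  refine integral_congr_ae ?_
  filter_upwards [hf] with x hx
  rw [hx]
  rfl

theorem fourierCoeff_coeff_of_not_equivalent {ξ η : IrrepMatrix G} (h : ¬ ξ.Equivalent η)
    (i j : Fin η.dim) {f : G → ℂ} (hf : f =ᵐ[μ] fun x => η.mat x i j) :
    fourierCoeff μ f ξ = 0 := by
  ext b a
  refine Eq.trans ?_ (integral_mat_mul_star_of_not_equivalent μ ξ η h i j a b)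
  refine integral_congr_ae ?_
  filter_upwards [hf] with x hx
  rw [hx]
  rfl

/-- The series defining the operator, evaluated at a matrix coefficient. -/
theorem hasSum_symbol_coeff {ξ : UnitaryDual G → IrrepMatrix G}
    (hξ : IsChoiceOfRepresentatives ξ)
    (σ : ∀ c : UnitaryDual G, G → Matrix (Fin (ξ c).dim) (Fin (ξ c).dim) ℂ)
    (c : UnitaryDual G) (i j : Fin (ξ c).dim) {f : G → ℂ}
    (hf : f =ᵐ[μ] fun x => (ξ c).mat x i j) (x : G) :
    HasSum (fun c : UnitaryDual G =>
      ((ξ c).dim : ℂ) * ((ξ c).mat x * σ c x * fourierCoeff μ f (ξ c)).trace)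
      (((ξ c).mat x * σ c x) i j) := by
  have hd : ((ξ c).dim : ℂ) ≠ 0 := by exact_mod_cast (ξ c).dim_pos.ne'
  have h1 : ((ξ c).mat x * σ c x) i j
      = ((ξ c).dim : ℂ) * ((ξ c).mat x * σ c x * fourierCoeff μ f (ξ c)).trace := by
    have h2 : ((ξ c).mat x * σ c x * fourierCoeff μ f (ξ c)).trace
        = ((ξ c).mat x * σ c x) i j * ((ξ c).dim : ℂ)⁻¹ := by
      simp only [Matrix.trace, Matrix.diag_apply]
      rw [Finset.sum_eq_single i, Matrix.mul_apply, Finset.sum_eq_single j]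
      · rw [fourierCoeff_coeff_self μ (ξ c) i j i j hf, if_pos ⟨rfl, rfl⟩]
      · intro b _ hb
        rw [fourierCoeff_coeff_self μ (ξ c) i j i b hf, if_neg (fun h => hb h.2.symm), mul_zero]
      · simp
      · intro a _ ha
        rw [Matrix.mul_apply]
        refine Finset.sum_eq_zero fun b _ => ?_
        rw [fourierCoeff_coeff_self μ (ξ c) i j a b hf, if_neg (fun h => ha h.1.symm), mul_zero]
      · simp
    rw [h2]
    field_simp
  rw [h1]
  refine hasSum_single c fun c' hc' => ?_
  rw [fourierCoeff_coeff_of_not_equivalent μ (hξ.not_equivalent hc') i j hf, Matrix.mul_zero,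
    Matrix.trace_zero, mul_zero]

end Symbol

/-! ### Smooth functions in `L^p` -/

section Smooth

variable {E : Type*} [NormedAddCommGroup E] [NormedSpace ℝ E]
  {H : Type*} [TopologicalSpace H] {I : ModelWithCorners ℝ E H}
  {G : Type*} [Group G] [TopologicalSpace G] [ChartedSpace H G] [CompactSpace G]
  [MeasurableSpace G] [BorelSpace G]

variable (I G) in
/-- The inclusion of smooth into continuous functions. -/
def SmoothFun.toContinuousMapLinear : SmoothFun I G →ₗ[ℂ] C(G, ℂ) where
  toFun f := ⟨f, f.continuous⟩
  map_add' _ _ := rfl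
  map_smul' _ _ := rfl

theorem SmoothFun.continuous_toContinuousMapLinear :
    Continuous (SmoothFun.toContinuousMapLinear I G) := by
  rw [continuous_iff_continuousAt]
  intro f
  rw [ContinuousAt, ContinuousMap.tendsto_iff_tendstoUniformly]
  have h : Tendsto (fun g : SmoothFun I G => UniformFun.ofFun (iteratedLieDeriv [] (g : G → ℂ)))
      (𝓝 f) (𝓝 (UniformFun.ofFun (iteratedLieDeriv [] (f : G → ℂ)))) :=
    ((continuous_apply ([] : List (GroupLieAlgebra I G))).comp continuous_induced_dom).tendsto f
  exact UniformFun.tendsto_iff_tendstoUniformly.1 h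

theorem SmoothFun.toLp_eq (μ : Measure G) [IsFiniteMeasure μ] (p : ℝ≥0∞) [Fact (1 ≤ p)]
    (f : SmoothFun I G) :
    f.toLp p μ = ContinuousMap.toLp p μ ℂ (SmoothFun.toContinuousMapLinear I G f) := by
  refine Lp.ext ?_
  exact (MemLp.coeFn_toLp _).trans
    (ContinuousMap.coeFn_toLp (p := p) (𝕜 := ℂ) μ (SmoothFun.toContinuousMapLinear I G f)).symm

end Smooth

end RNuclear

open RNuclear in
theorem mainTheorem1
    {E : Type*} [NormedAddCommGroup E] [NormedSpace ℝ E] [FiniteDimensional ℝ E]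
    {H : Type*} [TopologicalSpace H] (I : ModelWithCorners ℝ E H) [I.Boundaryless]
    (G : Type*) [Group G] [TopologicalSpace G] [ChartedSpace H G] [LieGroup I ∞ G]
    [CompactSpace G] [T2Space G] [MeasurableSpace G] [BorelSpace G]
    (μ : Measure G) [μ.IsHaarMeasure] [IsProbabilityMeasure μ]
    (r : ℝ) (hr0 : 0 < r) (hr1 : r ≤ 1)
    (p₁ p₂ : ℝ≥0∞) [Fact (1 ≤ p₁)] [Fact (1 ≤ p₂)] (hp₁ : p₁ ≠ ⊤) (hp₂ : p₂ ≠ ⊤)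
    (ξ : UnitaryDual G → IrrepMatrix G) (hξ : IsChoiceOfRepresentatives ξ)
    (σ : ∀ c : UnitaryDual G, G → Matrix (Fin (ξ c).dim) (Fin (ξ c).dim) ℂ)
    (hσ : ∀ c i j, AEStronglyMeasurable (fun x => σ c x i j) μ)
    (hsum : ∑' c : UnitaryDual G, ((ξ c).dim : ℝ≥0∞) ^ (2 + r / (min 2 p₁).toReal) *
      (eLpNorm (fun x => (opNormLinfty (σ c x)ᵀ : ℝ)) p₂ μ) ^ r < ⊤) :
    ∃ T : Lp ℂ p₁ μ →L[ℂ] Lp ℂ p₂ μ,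
      IsRNuclear r T ∧
      (∀ f : Lp ℂ p₁ μ, ∀ᵐ x ∂μ, HasSum
        (fun c : UnitaryDual G =>
          ((ξ c).dim : ℂ) * ((ξ c).mat x * σ c x * fourierCoeff μ f (ξ c)).trace) (T f x)) ∧
      ∀ A : SmoothFun I G →L[ℂ] Distrib I G, IsMatrixSymbol A μ ξ σ →
        ∀ f : SmoothFun I G, (A f).IsRepresentedBy (T (f.toLp p₁ μ)) μ := by
  have : IsTopologicalGroup G := topologicalGroup_of_lieGroup I ∞
  have : SecondCountableTopology H := I.secondCountableTopology
  have : SecondCountableTopology G := ChartedSpace.secondCountable_of_sigmaCompact H G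
  have : Countable (UnitaryDual G) := countable_unitaryDual hξ μ
  obtain ⟨T, hT, hTsum⟩ := exists_isRNuclear_of_symbol μ hr0 hr1 hp₁ ξ σ hσ hsum
  refine ⟨T, hT, hTsum, fun A hA f => ⟨(Lp.memLp _).integrable Fact.out, fun φ => ?_⟩⟩
  let Φ : C(G, ℂ) := SmoothFun.toContinuousMapLinear I G φ
  let D : SmoothFun I G →ₗ[ℂ] ℂ :=
    ((PointwiseConvergenceCLM.evalCLM (RingHom.id ℂ) ℂ φ).comp A).toLinearMap -
      (((integralMulCLM μ p₂ Φ).comp T).comp (ContinuousMap.toLp p₁ μ ℂ)).toLinearMap ∘ₗ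
        SmoothFun.toContinuousMapLinear I G
  have hD : ∀ u, D u = A u φ - ∫ x, T (u.toLp p₁ μ) x * φ x ∂μ := by
    intro u
    rw [SmoothFun.toLp_eq]
    rfl
  have hDc : Continuous D :=
    ((PointwiseConvergenceCLM.evalCLM (RingHom.id ℂ) ℂ φ).comp A).continuous.sub
      ((((integralMulCLM μ p₂ Φ).comp T).comp (ContinuousMap.toLp p₁ μ ℂ)).continuous.comp
        SmoothFun.continuous_toContinuousMapLinear)
  have htop : LinearMap.ker D = ⊤ := by
    refine eq_top_of_coeff_mem μ hξ _ (isClosed_singleton.preimage hDc) fun c i j u hu => ?_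
    rw [LinearMap.mem_ker, hD, sub_eq_zero]
    obtain ⟨Aξ, hA1, hA2⟩ := hA c
    rw [(hA1 i j u hu).2 φ]
    have hae : (u.toLp p₁ μ : G → ℂ) =ᵐ[μ] fun x => (ξ c).mat x i j :=
      (MemLp.coeFn_toLp _).trans (ae_of_all _ hu)
    refine integral_congr_ae ?_
    filter_upwards [hTsum (u.toLp p₁ μ), hA2] with x h1 h2
    rw [h1.unique (hasSum_symbol_coeff μ hξ σ c i j hae x), h2, ← Matrix.mul_assoc,
      (ξ c).mat_mul_conjTranspose, Matrix.one_mul]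
  have hf : f ∈ LinearMap.ker D := htop ▸ Submodule.mem_top
  rw [LinearMap.mem_ker, hD, sub_eq_zero] at hf
  exact hf
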